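/- Let $n,m,p\ge 1$, let $x_1,\dots,x_n\in\mathbb R^p$ be unit vectors, pairwise non-parallel ($x_i\nparallel x_j$ for $i\ne j$), and let $y_1,\dots,y_n\in\mathbb R$ with $|y_i|<B$. Let $\sigma(z)=\max\{z,0\}$, and for $W=(w_1,\dots,w_m)\in(\mathbb R^p)^m$ and $a\in\mathbb R^m$ put $$f(W,a,x)=\frac1{\sqrt m}\sum_{r=1}^m a_r\,\sigma(w_r^\top x),\qquad L(W,a)=\frac12\sum_{i=1}^n\bigl(f(W,a,x_i)-y_i\bigr)^2 .$$ Let $\lambda_0$ be the smallest eigenvalue of the matrix $H^\infty\in\mathbb R^{n\times n}$ with entries $H^\infty_{ij}=\mathbb E_{w\sim N(0,I)}\bigl[x_i^\top x_j\,\mathbb I\{w^\top x_i\ge 0,\ w^\top x_j\ge 0\}\bigr]$ (for such data $\lambda_0>0$). **Theorem.** Let $\gamma>6$ and $4<\alpha\le 2\gamma/3$. There is a constant $C=C(\alpha,\gamma)>0$, and for every $B$ a constant $K=K(\alpha,\gamma,B)>0$, such that for all data as above, all $\delta\in(0,1)$ and all widths $$m\ \ge\ K\,\frac{n^{5\alpha/2-4}}{\delta^{3\alpha/2-3}\,\lambda_0^{3\alpha/2-2}}$$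 the following holds. Let $w_r(0)\sim N(0,I)$ and $a_r\sim\mathrm{unif}\{-1,1\}$, $r=1,\dots,m$, be independent. Then, with probability at least $1-\delta$ over the initialization, every solution $W:[0,\infty)\to(\mathbb R^p)^m$ of the Nesterov ODE (with $a$ fixed) $$\ddot w_r(t)+\frac{\gamma}{t}\,\dot w_r(t)+\frac{\partial L(W(t),a)}{\partial w_r}=0\quad(r=1,\dots,m),\qquad \dot w_r(0)=0,$$ started at $W(0)$, satisfies, for all $t>0$, $$L(W(t),a)\ \le\ A(\alpha,\gamma,\lambda_0)\;t^{-\alpha}\;L(W(0),a),\qquad A(\alpha,\gamma,\lambda_0)=\frac{C(\alpha,\gamma)}{(\lambda_0/2)^{\alpha/2}} .$$ Here $\frac{\partial L}{\partial w_r}=\sum_i (f(W,a,x_i)-y_i)\,\frac{1}{\sqrt m}\,a_r\,\sigma'(w_r^\top x_i)\,x_i$ with $\sigma'(z)=1$ for $z>0$, $\sigma'(z)=0$ for $z<0$ and $\sigma'(0)$ any value in $[0,1]$; a solution is a continuously differentiable $W$ whose velocity is locally absolutely continuous on $(0,\infty)$ and which satisfies the equation for almost every $t>0$. -/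

import Mathlib

open MeasureTheory ProbabilityTheory
open scoped RealInnerProductSpace

/-- The ReLU activation. -/
noncomputable def relu (z : ℝ) : ℝ := max z 0

/-- The admissible values of `σ'(z)` for the ReLU `σ`: `1` if `z > 0`, `0` if `z < 0`, and any number
of `[0, 1]` at the kink `z = 0`.  In particular both conventions `σ'(z) = 𝕀(z ≥ 0)` and
`σ'(z) = 𝕀(z > 0)` are covered. -/
def reluSlope (z : ℝ) : Set ℝ := {s | (0 < z → s = 1) ∧ (z < 0 → s = 0) ∧ 0 ≤ s ∧ s ≤ 1}

/-- The two-layer network `f(W, a, x) = m^{-1/2} ∑ᵣ aᵣ σ(wᵣᵀ x)`. -/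
noncomputable def network {m p : ℕ} (W : Fin m → EuclideanSpace ℝ (Fin p)) (a : Fin m → ℝ)
    (x : EuclideanSpace ℝ (Fin p)) : ℝ :=
  1 / √(m : ℝ) * ∑ r, a r * relu ⟪W r, x⟫

/-- The squared loss `L(W, a) = ½ ∑ᵢ (f(W, a, xᵢ) - yᵢ)²` on the training set `(xᵢ, yᵢ)`. -/
noncomputable def loss {n m p : ℕ} (x : Fin n → EuclideanSpace ℝ (Fin p)) (y : Fin n → ℝ)
    (W : Fin m → EuclideanSpace ℝ (Fin p)) (a : Fin m → ℝ) : ℝ :=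
  1 / 2 * ∑ i, (network W a (x i) - y i) ^ 2

/-- `g` is a value of the gradient `(∂L/∂wᵣ)ᵣ` at `W`:
`∂L/∂wᵣ = ∑ᵢ (fᵢ - yᵢ) ∂fᵢ/∂wᵣ` with `∂fᵢ/∂wᵣ = m^{-1/2} aᵣ σ'(wᵣᵀ xᵢ) xᵢ`. -/
def IsLossGradient {n m p : ℕ} (x : Fin n → EuclideanSpace ℝ (Fin p)) (y : Fin n → ℝ)
    (W : Fin m → EuclideanSpace ℝ (Fin p)) (a : Fin m → ℝ)
    (g : Fin m → EuclideanSpace ℝ (Fin p)) : Prop :=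
  ∃ s : Fin m → Fin n → ℝ, (∀ r i, s r i ∈ reluSlope ⟪W r, x i⟫) ∧
    ∀ r, g r = ∑ i, ((network W a (x i) - y i) * (1 / √(m : ℝ) * a r * s r i)) • x i

/-- `W : [0, ∞) → (ℝᵖ)ᵐ` is a solution of the Nesterov flow
`ẅᵣ(t) + (γ / t) ẇᵣ(t) + ∂L/∂wᵣ = 0`, `W(0) = W₀`, `Ẇ(0) = 0`.  As `∂L/∂wᵣ` is discontinuous, this is
meant in the Carathéodory sense: `W` is continuously differentiable with velocity `V`, the velocity
is locally absolutely continuous on `(0, ∞)`, and the equation holds for almost every `t > 0`. -/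
structure IsNesterovFlow {n m p : ℕ} (γ : ℝ) (x : Fin n → EuclideanSpace ℝ (Fin p))
    (y : Fin n → ℝ) (a : Fin m → ℝ) (W₀ : Fin m → EuclideanSpace ℝ (Fin p))
    (W V : ℝ → Fin m → EuclideanSpace ℝ (Fin p)) : Prop where
  init_pos : W 0 = W₀
  init_vel : V 0 = 0
  hasDeriv : ∀ r, ∀ t, 0 ≤ t →
    HasDerivWithinAt (fun τ => W τ r) (V t r) (Set.Ici 0) t
  continuous_vel : ∀ r, ContinuousOn (fun τ => V τ r) (Set.Ici 0)
  absCont_vel : ∀ r, ∀ t₁ t₂, 0 < t₁ → t₁ ≤ t₂ →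
    AbsolutelyContinuousOnInterval (fun τ => V τ r) t₁ t₂
  equation : ∀ᵐ t ∂(volume.restrict (Set.Ioi (0 : ℝ))), ∃ g, IsLossGradient x y (W t) a g ∧
    ∀ r, HasDerivAt (fun τ => V τ r) (-((γ / t) • V t r) - g r) t

open Classical in
/-- The limiting Gram matrix
`(H^∞)ᵢⱼ = 𝔼_{w ∼ N(0, I)} [xᵢᵀ xⱼ 𝕀{wᵀ xᵢ ≥ 0, wᵀ xⱼ ≥ 0}]`. -/
noncomputable def gramInfty {n p : ℕ} (x : Fin n → EuclideanSpace ℝ (Fin p)) :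
    Matrix (Fin n) (Fin n) ℝ :=
  Matrix.of fun i j => ∫ w, (if 0 ≤ ⟪w, x i⟫ ∧ 0 ≤ ⟪w, x j⟫ then ⟪x i, x j⟫ else 0)
    ∂(stdGaussian (EuclideanSpace ℝ (Fin p)))

/-- `λ₀`, the smallest eigenvalue of the (symmetric) matrix `H^∞`. -/
noncomputable def lambdaZero {n p : ℕ} (x : Fin n → EuclideanSpace ℝ (Fin p)) : ℝ :=
  sInf (spectrum ℝ (gramInfty x))

/-- The law of the initialization `(W(0), a)`: independent `wᵣ ∼ N(0, I)` and
`aᵣ ∼ unif{-1, 1}`, `r = 1, …, m`. -/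
noncomputable def initLaw (m p : ℕ) :
    Measure ((Fin m → EuclideanSpace ℝ (Fin p)) × (Fin m → ℝ)) :=
  (Measure.pi fun _ : Fin m => stdGaussian (EuclideanSpace ℝ (Fin p))).prod
    (Measure.pi fun _ : Fin m => uniformOn ({-1, 1} : Set ℝ))

/-! Let `u` be the residual vector, `p` the stacked velocity and `J` the Jacobian of the outputs
with the current activation slopes. The flow reads `u' = J p`, `p' = -(γ/t) p - Jᵀ u`, so `‖u‖² +
‖p‖²` never increases. Friction acts on `p` only; to get decay of `u`, take a right inverse `Q` of
the initial Jacobian `J₀`, which satisfies `J₀ J₀ᵀ ≥ c` with `c = λ₀/2`. If `J` stays close to `J₀`,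
then `t^α (‖u‖² + ‖p‖²)/2 + (γ/2) t^(α-1) ⟪Q u, p⟫` does not increase beyond a time of order
`c^(-1/2)` (`sq_norm_le_rpow_mul`).

Closeness is obtained by a bootstrap. Decay of `u` like `t^(-α/2)` bounds the speed of each weight
by a multiple of `√(n/m) t^(1-α/2)`, integrable at infinity because `α > 4`. Hence no weight moves
further than order `√(n/m) ‖u(0)‖/c` (`norm_pos_sub_le`). For large `m` this is below a radius `R`
at which only few gates can change, so the weights never travel as far as `R`
(`IsNesterovFlow.loss_le`).

The kinks cost nothing: where a preactivation vanishes and its ReLU is differentiable, the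
preactivation has derivative zero, so every admissible slope satisfies the chain rule
(`hasDerivAt_relu_comp`). The slopes chosen by the gradient may therefore be used in `u' = J p`, and
the energy terms cancel.

Randomness enters through second moments, a density bound and Markov's inequality
(`exists_good_initialization`), for the initial loss, the empirical Gram matrix and the number of
preactivations near zero. Positivity of `λ₀` comes from flipping one gate at a time
(`posDef_gramInfty`). -/

section

open Set Filter Topology

/-! ### Calculus of absolutely continuous curves. -/

namespace AbsolutelyContinuousOnInterval

/-- An absolutely continuous function whose derivative is almost everywhere nonpositive does not
increase. -/
theorem le_of_ae_hasDerivAt_nonpos {f : ℝ → ℝ} {a b : ℝ} (hab : a ≤ b)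
    (hf : AbsolutelyContinuousOnInterval f a b)
    (h : ∀ᵐ t, t ∈ Ioo a b → ∃ d ≤ 0, HasDerivAt f d t) : f b ≤ f a := by
  have h1 : ∫ t in a..b, deriv f t ≤ 0 := by
    rw [intervalIntegral.integral_of_le hab, ← integral_Ioc_eq_integral_Ioo.symm]
    apply integral_nonpos_of_ae
    rw [EventuallyLE, ae_restrict_iff' measurableSet_Ioo]
    filter_upwards [h] with t ht hmem
    obtain ⟨d, hd, hd'⟩ := ht hmem
    simpa [hd'.deriv] using hd
  rw [hf.integral_deriv_eq_sub] at h1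
  linarith

/-- One criterion serves Lipschitz images (linear maps, the ReLU) and bilinear expressions such as
inner products. -/
theorem of_dist_le_add {X Y Z : Type*} [PseudoMetricSpace X] [PseudoMetricSpace Y]
    [PseudoMetricSpace Z] {f : ℝ → X} {g : ℝ → Y} {φ : ℝ → Z} {a b C D : ℝ}
    (hf : AbsolutelyContinuousOnInterval f a b) (hg : AbsolutelyContinuousOnInterval g a b)
    (h : ∀ s ∈ uIcc a b, ∀ t ∈ uIcc a b,
      dist (φ s) (φ t) ≤ C * dist (f s) (f t) + D * dist (g s) (g t)) :
    AbsolutelyContinuousOnInterval φ a b := by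
  unfold AbsolutelyContinuousOnInterval at hf hg
  apply squeeze_zero' ?_ ?_ (by simpa using (hf.const_mul C).add (hg.const_mul D))
  · exact Eventually.of_forall fun _ => Finset.sum_nonneg fun i hi => dist_nonneg
  rw [eventually_inf_principal]
  filter_upwards with (n, I) hnI
  simp only [Finset.mul_sum, ← Finset.sum_add_distrib]
  refine Finset.sum_le_sum fun i hi => ?_
  exact h _ (hnI.1 i hi).1 _ (hnI.1 i hi).2

theorem of_dist_le {X Z : Type*} [PseudoMetricSpace X] [PseudoMetricSpace Z] {f : ℝ → X}
    {φ : ℝ → Z} {a b C : ℝ} (hf : AbsolutelyContinuousOnInterval f a b)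
    (h : ∀ s ∈ uIcc a b, ∀ t ∈ uIcc a b, dist (φ s) (φ t) ≤ C * dist (f s) (f t)) :
    AbsolutelyContinuousOnInterval φ a b :=
  hf.of_dist_le_add hf (C := C) (D := 0) (by simpa using h)

theorem clm_comp {E F : Type*} [NormedAddCommGroup E] [NormedSpace ℝ E] [NormedAddCommGroup F]
    [NormedSpace ℝ F] {f : ℝ → E} {a b : ℝ} (L : E →L[ℝ] F)
    (hf : AbsolutelyContinuousOnInterval f a b) :
    AbsolutelyContinuousOnInterval (fun t => L (f t)) a b :=
  hf.of_dist_le (C := ‖L‖) fun s _ t _ => by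
    rw [dist_eq_norm, dist_eq_norm, ← map_sub]; exact L.le_opNorm _

theorem inner {E : Type*} [NormedAddCommGroup E] [InnerProductSpace ℝ E] {f g : ℝ → E} {a b : ℝ}
    (hf : AbsolutelyContinuousOnInterval f a b) (hg : AbsolutelyContinuousOnInterval g a b) :
    AbsolutelyContinuousOnInterval (fun t => ⟪f t, g t⟫) a b := by
  obtain ⟨C, hC⟩ := hf.exists_bound
  obtain ⟨D, hD⟩ := hg.exists_bound
  refine hf.of_dist_le_add hg (C := D) (D := C) fun s hs t ht => ?_
  have key : ⟪f s, g s⟫ - ⟪f t, g t⟫ = ⟪f s - f t, g s⟫ + ⟪f t, g s - g t⟫ := by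
    rw [inner_sub_left, inner_sub_right]; ring
  rw [Real.dist_eq, key, dist_eq_norm, dist_eq_norm]
  refine (abs_add_le _ _).trans (add_le_add ?_ ?_)
  · refine (abs_real_inner_le_norm _ _).trans ?_
    rw [mul_comm]
    exact mul_le_mul_of_nonneg_right (hD s hs) (norm_nonneg _)
  · refine (abs_real_inner_le_norm _ _).trans ?_
    exact mul_le_mul_of_nonneg_right (hC t ht) (norm_nonneg _)

theorem pi {ι : Type*} [Fintype ι] {X : ι → Type*} [∀ i, PseudoMetricSpace (X i)]
    {f : ℝ → ∀ i, X i} {a b : ℝ}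
    (hf : ∀ i, AbsolutelyContinuousOnInterval (fun t => f t i) a b) :
    AbsolutelyContinuousOnInterval f a b := by
  unfold AbsolutelyContinuousOnInterval at hf ⊢
  apply squeeze_zero (fun t => ?_) (fun t => ?_)
    (by simpa using tendsto_finsetSum Finset.univ fun i _ => hf i)
  · exact Finset.sum_nonneg fun i hi => dist_nonneg
  · rw [Finset.sum_comm]
    refine Finset.sum_le_sum fun k _ => ?_
    exact (dist_pi_le_iff (Finset.sum_nonneg fun i hi => dist_nonneg)).2 fun i =>
      Finset.single_le_sum (f := fun i => dist (f (t.2 k).1 i) (f (t.2 k).2 i))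
        (fun i hi => dist_nonneg) (Finset.mem_univ i)

theorem piLp {ι : Type*} [Fintype ι] {E : ι → Type*} [∀ i, NormedAddCommGroup (E i)]
    [∀ i, NormedSpace ℝ (E i)] {f : ℝ → ∀ i, E i} {a b : ℝ}
    (hf : ∀ i, AbsolutelyContinuousOnInterval (fun t => f t i) a b) :
    AbsolutelyContinuousOnInterval (fun t => WithLp.toLp 2 (f t)) a b :=
  (AbsolutelyContinuousOnInterval.pi hf).clm_comp
    (PiLp.continuousLinearEquiv 2 ℝ E).symm.toContinuousLinearMap

theorem rpow {a b : ℝ} (ha : 0 < a) (hab : a ≤ b) (s : ℝ) :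
    AbsolutelyContinuousOnInterval (fun t : ℝ => t ^ s) a b := by
  apply ContDiffOn.absolutelyContinuousOnInterval
  rw [uIcc_of_le hab]
  intro t ht
  exact (Real.contDiffAt_rpow_const_of_ne (ha.trans_le ht.1).ne').contDiffWithinAt

end AbsolutelyContinuousOnInterval

/-! ### The Lyapunov argument for the abstract damped system. -/

section Decay

variable {U X : Type*} [NormedAddCommGroup U] [InnerProductSpace ℝ U] [NormedAddCommGroup X]
  [InnerProductSpace ℝ X]

/-- The mechanical energy of a damped system does not increase. -/
theorem energy_le {γ t T : ℝ} (hγ : 0 ≤ γ) {u : ℝ → U} {p : ℝ → X}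
    (hu : ContinuousOn u (Icc 0 T)) (hp : ContinuousOn p (Icc 0 T))
    (huac : ∀ a b, 0 < a → a ≤ b → b ≤ T → AbsolutelyContinuousOnInterval u a b)
    (hpac : ∀ a b, 0 < a → a ≤ b → b ≤ T → AbsolutelyContinuousOnInterval p a b)
    (hode : ∀ᵐ t, t ∈ Ioo 0 T → ∃ u' g, HasDerivAt u u' t ∧
      HasDerivAt p (-((γ / t) • p t) - g) t ∧ ⟪u t, u'⟫ = ⟪g, p t⟫)
    (ht : t ∈ Icc 0 T) :
    ‖u t‖ ^ 2 + ‖p t‖ ^ 2 ≤ ‖u 0‖ ^ 2 + ‖p 0‖ ^ 2 := by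
  -- Absolute continuity is available only away from the singular time 0, so the energy is compared
  -- on `[s, t]` and `s → 0` is taken by continuity.
  have hmono : ∀ s ∈ Ioo 0 t, ‖u t‖ ^ 2 + ‖p t‖ ^ 2 ≤ ‖u s‖ ^ 2 + ‖p s‖ ^ 2 := by
    intro s hs
    have hu1 := huac s t hs.1 hs.2.le ht.2
    have hp1 := hpac s t hs.1 hs.2.le ht.2
    have := ((hu1.inner hu1).fun_add (hp1.inner hp1)).le_of_ae_hasDerivAt_nonpos hs.2.le ?_
    · simpa only [real_inner_self_eq_norm_sq] using this
    filter_upwards [hode] with τ hτ hmem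
    have hτ0 : 0 < τ := hs.1.trans hmem.1
    obtain ⟨u', g, h1, h2, h3⟩ := hτ ⟨hτ0, hmem.2.trans_le ht.2⟩
    refine ⟨_, ?_, (h1.inner ℝ h1).add (h2.inner ℝ h2)⟩
    have e1 : ⟪u', u τ⟫ = ⟪g, p τ⟫ := by rw [real_inner_comm, h3]
    simp only [inner_sub_left, inner_sub_right, inner_neg_left, inner_neg_right,
      real_inner_smul_left, real_inner_smul_right, h3, e1, real_inner_self_eq_norm_sq]
    rw [real_inner_comm]
    have : 0 ≤ γ / τ * ‖p τ‖ ^ 2 := by positivity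
    linarith
  rcases ht.1.eq_or_lt with h0 | h0
  · rw [← h0]
  have hc : ContinuousOn (fun s => ‖u s‖ ^ 2 + ‖p s‖ ^ 2) (Icc 0 T) := by fun_prop
  have hT : (0 : ℝ) ∈ Icc 0 T := ⟨le_rfl, ht.1.trans ht.2⟩
  have hlim : Tendsto (fun s => ‖u s‖ ^ 2 + ‖p s‖ ^ 2) (𝓝[Ioo 0 t] 0)
      (𝓝 (‖u 0‖ ^ 2 + ‖p 0‖ ^ 2)) :=
    (hc 0 hT).mono_left (nhdsWithin_mono _ fun s hs => ⟨hs.1.le, hs.2.le.trans ht.2⟩)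
  have : (𝓝[Ioo 0 t] (0:ℝ)).NeBot := by
    rw [nhdsWithin_Ioo_eq_nhdsGT h0]; infer_instance
  exact ge_of_tendsto hlim (eventually_mem_nhdsWithin.mono hmono)

/-- Polynomial decay for the damped system `u' = J p`, `p' = -(γ / t) p - Jᵀ u`, where `J` is only
known to be close to an operator with right inverse `Q`. -/
theorem sq_norm_le_rpow_mul {γ α q t T : ℝ} (hγ : 0 < γ) (hα : 0 < α) (hαγ : α ≤ 2 * γ / 3)
    (hq : 0 < q) {u : ℝ → U} {p : ℝ → X} {Q : U →L[ℝ] X} (hQ : ∀ z, ‖Q z‖ ≤ q * ‖z‖)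
    (hu : ContinuousOn u (Icc 0 T)) (hp : ContinuousOn p (Icc 0 T)) (hp0 : p 0 = 0)
    (huac : ∀ a b, 0 < a → a ≤ b → b ≤ T → AbsolutelyContinuousOnInterval u a b)
    (hpac : ∀ a b, 0 < a → a ≤ b → b ≤ T → AbsolutelyContinuousOnInterval p a b)
    (hode : ∀ᵐ t, t ∈ Ioo 0 T → ∃ u' g, HasDerivAt u u' t ∧
      HasDerivAt p (-((γ / t) • p t) - g) t ∧ ⟪u t, u'⟫ = ⟪g, p t⟫ ∧
      ⟪Q u', p t⟫ ≤ 7 / 6 * ‖p t‖ ^ 2 ∧ 5 / 6 * ‖u t‖ ^ 2 ≤ ⟪Q (u t), g⟫)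
    (ht : t ∈ Ioc 0 T) :
    ‖u t‖ ^ 2 ≤ 2 * (3 * (1 + γ + α) * q / t) ^ α * ‖u 0‖ ^ 2 := by
  have hen : ∀ s ∈ Icc 0 T, ‖u s‖ ^ 2 + ‖p s‖ ^ 2 ≤ ‖u 0‖ ^ 2 := by
    intro s hs
    have := energy_le hγ.le hu hp huac hpac (hode.mono fun t h1 h2 => by
      obtain ⟨u', g, h3, h4, h5, -⟩ := h1 h2
      exact ⟨u', g, h3, h4, h5⟩) hs
    simpa [hp0] using this
  -- Beyond `τ` the ratio `q / s` is at most `1 / (3 (1 + γ + α))`, so the cross term is at most a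
  -- sixth of the energy. Before `τ` the claim is mere energy monotonicity, as `(τ / t) ^ α ≥ 1`.
  set τ := 3 * (1 + γ + α) * q with hτ
  have hτ0 : 0 < τ := by positivity
  rcases le_total t τ with htτ | htτ
  · have h1 : 1 ≤ (τ / t) ^ α := Real.one_le_rpow ((one_le_div ht.1).2 htτ) hα.le
    have h2 := hen t ⟨ht.1.le, ht.2⟩
    nlinarith [sq_nonneg ‖p t‖, sq_nonneg ‖u 0‖]
  have hcross : ∀ s, |⟪Q (u s), p s⟫| ≤ q * ((‖u s‖ ^ 2 + ‖p s‖ ^ 2) / 2) := by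
    intro s
    refine (abs_real_inner_le_norm _ _).trans ?_
    have h1 := mul_le_mul_of_nonneg_right (hQ (u s)) (norm_nonneg (p s))
    have h2 : ‖u s‖ * ‖p s‖ ≤ (‖u s‖ ^ 2 + ‖p s‖ ^ 2) / 2 := by
      nlinarith [sq_nonneg (‖u s‖ - ‖p s‖)]
    nlinarith [mul_le_mul_of_nonneg_left h2 hq.le]
  have hqs : ∀ s, τ ≤ s → q / s ≤ 1 / (3 * (1 + γ + α)) := by
    intro s hs
    rw [div_le_div_iff₀ (hτ0.trans_le hs) (by positivity)]
    linarith
  have hcross' : ∀ s, τ ≤ s →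
      |γ / 2 * s⁻¹ * ⟪Q (u s), p s⟫| ≤ 1 / 6 * ((‖u s‖ ^ 2 + ‖p s‖ ^ 2) / 2) := by
    intro s hs
    have hs0 := hτ0.trans_le hs
    rw [abs_mul, abs_of_pos (by positivity : 0 < γ / 2 * s⁻¹)]
    have h1 := mul_le_mul_of_nonneg_left (hcross s) (by positivity : 0 ≤ γ / 2 * s⁻¹)
    have h2 : γ / 2 * s⁻¹ * q ≤ 1 / 6 := by
      have := mul_le_mul_of_nonneg_left (hqs s hs) (by positivity : 0 ≤ γ / 2)
      have h3 : γ / 2 * (1 / (3 * (1 + γ + α))) ≤ 1 / 6 := by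
        rw [mul_one_div, div_div, div_le_div_iff₀ (by positivity) (by positivity)]; nlinarith
      calc _ = γ / 2 * (q / s) := by ring
        _ ≤ _ := this.trans h3
    have h4 : 0 ≤ (‖u s‖ ^ 2 + ‖p s‖ ^ 2) / 2 := by positivity
    nlinarith [mul_le_mul_of_nonneg_right h2 h4]
  set F : ℝ → ℝ := fun s => s ^ α * ((1 / 2) * (⟪u s, u s⟫ + ⟪p s, p s⟫)) +
    γ / 2 * (s ^ (α - 1) * ⟪Q (u s), p s⟫) with hF
  have hFeq : ∀ s, 0 < s → F s = s ^ α *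
      ((‖u s‖ ^ 2 + ‖p s‖ ^ 2) / 2 + γ / 2 * s⁻¹ * ⟪Q (u s), p s⟫) := by
    intro s hs
    simp only [hF, real_inner_self_eq_norm_sq, Real.rpow_sub_one hs.ne']
    field_simp
  have hFle : F t ≤ F τ := by
    have hu1 := huac τ t hτ0 htτ ht.2
    have hp1 := hpac τ t hτ0 htτ ht.2
    have hac : AbsolutelyContinuousOnInterval F τ t :=
      ((AbsolutelyContinuousOnInterval.rpow hτ0 htτ α).fun_mul
        (((hu1.inner hu1).fun_add (hp1.inner hp1)).const_mul (1 / 2))).fun_add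
      (((AbsolutelyContinuousOnInterval.rpow hτ0 htτ (α - 1)).fun_mul
        ((hu1.clm_comp Q).inner hp1)).const_mul (γ / 2))
    refine hac.le_of_ae_hasDerivAt_nonpos htτ ?_
    filter_upwards [hode] with s hs hmem
    have hs0 : 0 < s := hτ0.trans hmem.1
    obtain ⟨u', g, h1, h2, h3, h4, h5⟩ := hs ⟨hs0, hmem.2.trans_le ht.2⟩
    refine ⟨_, ?_, ((Real.hasDerivAt_rpow_const (Or.inl hs0.ne')).mul
      (((h1.inner ℝ h1).add (h2.inner ℝ h2)).const_mul (1 / 2))).add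
      (((Real.hasDerivAt_rpow_const (p := α - 1) (Or.inl hs0.ne')).mul
        ((Q.hasFDerivAt.comp_hasDerivAt s h1).inner ℝ h2)).const_mul (γ / 2))⟩
    have e1 : ⟪u', u s⟫ = ⟪g, p s⟫ := by rw [real_inner_comm, h3]
    have e2 : ⟪p s, g⟫ = ⟪g, p s⟫ := real_inner_comm _ _
    simp only [inner_sub_left, inner_sub_right, inner_neg_left, inner_neg_right, Function.comp_apply, Pi.add_apply,
      real_inner_smul_left, real_inner_smul_right, h3, e1, e2, real_inner_self_eq_norm_sq]
    have hsα : 0 < s ^ α := by positivity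
    rw [Real.rpow_sub_one hs0.ne' (α - 1), Real.rpow_sub_one hs0.ne' α]
    have hI := hcross s
    have hsq := hqs s hmem.1.le
    set I := ⟪Q (u s), p s⟫
    set E := (‖u s‖ ^ 2 + ‖p s‖ ^ 2) / 2 with hE
    have hE0 : 0 ≤ E := by positivity
    -- This is the derivative of `F` divided by `s ^ (α - 1)`. With `α ≤ 2γ/3` the constants balance
    -- exactly: `‖u‖²` gets `γ/3 + γ/12 - 5γ/12 = 0` and `‖p‖²` gets `γ/3 + γ/12 - γ + 7γ/12 = 0`.
    have hmain : α * E + -γ * ‖p s‖ ^ 2 + γ / 2 * (⟪Q u', p s⟫ - ⟪Q (u s), g⟫) +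
        γ / 2 * (α - 1 - γ) * (I / s) ≤ 0 := by
      have h6 : γ / 2 * (⟪Q u', p s⟫ - ⟪Q (u s), g⟫) ≤
          γ / 2 * (7 / 6 * ‖p s‖ ^ 2 - 5 / 6 * ‖u s‖ ^ 2) := by gcongr
      have h7 : (α - 1 - γ) * (I / s) ≤ E / 3 := by
        have h8 : |(α - 1 - γ) * (I / s)| ≤ (1 + γ + α) * (q / s * E) := by
          rw [abs_mul]
          gcongr
          · rw [abs_le]; constructor <;> linarith
          · rw [abs_div, abs_of_pos hs0, div_mul_eq_mul_div]; gcongr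
        have h9 : (1 + γ + α) * (q / s * E) ≤ (1 + γ + α) * (1 / (3 * (1 + γ + α)) * E) := by
          gcongr
        have h10 : (1 + γ + α) * (1 / (3 * (1 + γ + α)) * E) = E / 3 := by
          field_simp
        exact (le_abs_self _).trans (h8.trans (h9.trans h10.le))
      have h11 : γ / 2 * (α - 1 - γ) * (I / s) ≤ γ / 2 * (E / 3) := by
        rw [mul_assoc]; gcongr
      have h12 : α * E ≤ 2 * γ / 3 * E := by gcongr
      have h13 : 0 ≤ γ * ‖p s‖ ^ 2 := by positivity
      have h14 : 0 ≤ γ * ‖u s‖ ^ 2 := by positivity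
      rw [hE] at h11 h12 ⊢
      nlinarith
    have := mul_nonpos_of_nonneg_of_nonpos (by positivity : 0 ≤ s ^ α / s) hmain
    refine le_of_eq_of_le ?_ this
    rw [hE]
    field_simp
    ring
  have h1 := hFle
  rw [hFeq t ht.1, hFeq τ hτ0] at h1
  have h2 := hcross' t htτ
  have h3 := hcross' τ le_rfl
  have h4 := hen τ ⟨hτ0.le, htτ.trans ht.2⟩
  rw [abs_le] at h2 h3
  have htα : 0 < t ^ α := Real.rpow_pos_of_pos ht.1 _
  have hτα : 0 < τ ^ α := by positivity
  rw [Real.div_rpow hτ0.le ht.1.le, mul_div_assoc', div_mul_eq_mul_div, le_div_iff₀ htα]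
  -- The cross term costs factors `5/6` and `7/6` at the two ends; the resulting ratio `7/5` is
  -- rounded up to 2.
  have h5 : t ^ α * (5 / 12 * (‖u t‖ ^ 2 + ‖p t‖ ^ 2)) ≤ τ ^ α * (7 / 12 * ‖u 0‖ ^ 2) := by
    calc _ ≤ _ := mul_le_mul_of_nonneg_left (by linarith [h2.1]) htα.le
      _ ≤ _ := h1
      _ ≤ _ := mul_le_mul_of_nonneg_left (by linarith [h3.2]) hτα.le
  have h6 : 0 ≤ t ^ α * ‖p t‖ ^ 2 := by positivity
  have h7 : 0 ≤ τ ^ α * ‖u 0‖ ^ 2 := by positivity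
  nlinarith

end Decay

/-! ### From decay of the force to bounded displacement. -/

section Displacement

variable {E : Type*} [NormedAddCommGroup E] [InnerProductSpace ℝ E]

/-- The integrating factor `t^γ` turns the equation into `(t^γ v)' = -t^γ g`, and the right side is
integrated from 0. Testing against unit vectors reduces this to scalar monotonicity. -/
theorem norm_velocity_le {γ β M t T : ℝ} (hβ : β < γ + 1) (hγ : 0 < γ) (hM : 0 ≤ M) {v : ℝ → E}
    (hv : ContinuousOn v (Icc 0 T))
    (hvac : ∀ a b, 0 < a → a ≤ b → b ≤ T → AbsolutelyContinuousOnInterval v a b)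
    (hode : ∀ᵐ t, t ∈ Ioo 0 T → ∃ g, HasDerivAt v (-((γ / t) • v t) - g) t ∧
      ‖g‖ ≤ M * t ^ (-β))
    (ht : t ∈ Ioc 0 T) : ‖v t‖ ≤ M * t ^ (1 - β) / (γ + 1 - β) := by
  have hβ' : 0 < γ + 1 - β := by linarith
  have key : ∀ e : E, ‖e‖ = 1 → ⟪e, v t⟫ ≤ M * t ^ (1 - β) / (γ + 1 - β) := by
    intro e he
    set φ : ℝ → ℝ := fun s => s ^ γ * ⟪e, v s⟫ - M / (γ + 1 - β) * s ^ (γ + 1 - β) with hφ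
    have hmono : ∀ s ∈ Ioo 0 t, φ t ≤ φ s := by
      intro s hs
      have hac : AbsolutelyContinuousOnInterval φ s t :=
        ((AbsolutelyContinuousOnInterval.rpow hs.1 hs.2.le γ).fun_mul
          ((hvac s t hs.1 hs.2.le ht.2).clm_comp (innerSL ℝ e))).fun_sub
        ((AbsolutelyContinuousOnInterval.rpow hs.1 hs.2.le (γ + 1 - β)).const_mul _)
      refine hac.le_of_ae_hasDerivAt_nonpos hs.2.le ?_
      filter_upwards [hode] with r hr hmem
      have hr0 : 0 < r := hs.1.trans hmem.1
      obtain ⟨g, h1, h2⟩ := hr ⟨hr0, hmem.2.trans_le ht.2⟩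
      refine ⟨_, ?_, ((Real.hasDerivAt_rpow_const (Or.inl hr0.ne')).mul
        ((innerSL ℝ e).hasFDerivAt.comp_hasDerivAt r h1)).sub
        ((Real.hasDerivAt_rpow_const (p := γ + 1 - β) (Or.inl hr0.ne')).const_mul _)⟩
      simp only [innerSL_apply_apply, Function.comp_apply, inner_sub_right, inner_neg_right,
        real_inner_smul_right]
      have h3 : -⟪e, g⟫ ≤ M * r ^ (-β) := by
        have := (abs_real_inner_le_norm e g)
        rw [he, one_mul] at this
        exact (neg_le_abs _).trans (this.trans h2)
      have e1 : r ^ (γ + 1 - β - 1) = r ^ γ * r ^ (-β) := by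
        rw [← Real.rpow_add hr0]; ring_nf
      rw [Real.rpow_sub_one hr0.ne', e1]
      have h4 := mul_le_mul_of_nonneg_left h3 (by positivity : 0 ≤ r ^ γ)
      refine le_of_eq_of_le ?_ (sub_nonpos.2 h4)
      field_simp
      ring
    have hlim : Tendsto φ (𝓝[Ioo 0 t] 0) (𝓝 0) := by
      have hsub : Ioo 0 t ⊆ Icc 0 T := fun s hs => ⟨hs.1.le, hs.2.le.trans ht.2⟩
      have h1 : Tendsto v (𝓝[Ioo 0 t] 0) (𝓝 (v 0)) :=
        (hv 0 ⟨le_rfl, ht.1.le.trans ht.2⟩).mono_left (nhdsWithin_mono _ hsub)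
      have h2 : ∀ s : ℝ, 0 < s → Tendsto (fun r : ℝ => r ^ s) (𝓝[Ioo 0 t] 0) (𝓝 0) := by
        intro s hs
        have := (Real.continuousAt_rpow_const 0 s (Or.inr hs.le)).tendsto
        rw [Real.zero_rpow hs.ne'] at this
        exact this.mono_left nhdsWithin_le_nhds
      have h3 : Tendsto (fun s => ⟪e, v s⟫) (𝓝[Ioo 0 t] 0) (𝓝 ⟪e, v 0⟫) :=
        tendsto_const_nhds.inner h1
      simpa using ((h2 γ hγ).mul h3).sub ((h2 _ hβ').const_mul (M / (γ + 1 - β)))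
    have : (𝓝[Ioo 0 t] (0:ℝ)).NeBot := by
      rw [nhdsWithin_Ioo_eq_nhdsGT ht.1]; infer_instance
    have h0 : φ t ≤ 0 := ge_of_tendsto hlim (eventually_mem_nhdsWithin.mono hmono)
    have htγ : 0 < t ^ γ := Real.rpow_pos_of_pos ht.1 _
    have e2 : t ^ (γ + 1 - β) = t ^ γ * t ^ (1 - β) := by
      rw [← Real.rpow_add ht.1]; ring_nf
    have h5 : t ^ γ * (⟪e, v t⟫ - M * t ^ (1 - β) / (γ + 1 - β)) ≤ 0 := by
      refine le_of_eq_of_le ?_ h0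
      simp only [hφ, e2]; ring
    by_contra hcon
    push Not at hcon
    nlinarith [mul_pos htγ (sub_pos.2 hcon)]
  by_cases h0 : v t = 0
  · rw [h0, norm_zero]
    have : 0 < t ^ (1 - β) := Real.rpow_pos_of_pos ht.1 _
    positivity
  · have hn : 0 < ‖v t‖ := norm_pos_iff.2 h0
    have := key (‖v t‖⁻¹ • v t) (by rw [norm_smul, norm_inv, norm_norm]; field_simp)
    rwa [real_inner_smul_left, real_inner_self_eq_norm_sq, pow_two, ← mul_assoc,
      inv_mul_cancel₀ hn.ne', one_mul] at this

/-- Split at `τ`: the linear speed bound handles early times, and afterwards `s^(1-β)` is integrable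
up to infinity since `β > 2`. The bound is thus uniform in `T`. -/
theorem norm_displacement_le {β M N τ t T : ℝ} (hβ : 2 < β) (hM : 0 ≤ M) (hN : 0 ≤ N)
    (hτ : 0 < τ) {w v : ℝ → E}
    (hw : ∀ t ∈ Icc 0 T, HasDerivWithinAt w (v t) (Ici 0) t)
    (h1 : ∀ t ∈ Icc 0 T, ‖v t‖ ≤ M * t)
    (h2 : ∀ t ∈ Ioc 0 T, ‖v t‖ ≤ N * t ^ (1 - β)) (ht : t ∈ Icc 0 T) :
    ‖w t - w 0‖ ≤ M * τ ^ 2 + N * τ ^ (2 - β) / (β - 2) := by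
  have hβ2 : 0 < β - 2 := by linarith
  have hlast : 0 ≤ N * τ ^ (2 - β) / (β - 2) := by positivity
  have hfirst : ∀ s ∈ Icc 0 T, s ≤ τ → ‖w s - w 0‖ ≤ M * τ ^ 2 := by
    intro s hs hsτ
    have := (convex_Icc 0 s).norm_image_sub_le_of_norm_hasDerivWithin_le (f := w) (f' := v)
      (C := M * τ) (x := 0) (y := s)
      (fun r hr => (hw r ⟨hr.1, hr.2.trans hs.2⟩).mono fun z hz => hz.1)
      (fun r hr => (h1 r ⟨hr.1, hr.2.trans hs.2⟩).trans
        (mul_le_mul_of_nonneg_left (hr.2.trans hsτ) hM)) ⟨le_rfl, hs.1⟩ ⟨hs.1, le_rfl⟩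
    rw [sub_zero, Real.norm_eq_abs, abs_of_nonneg hs.1] at this
    refine this.trans ?_
    rw [pow_two, ← mul_assoc]
    exact mul_le_mul_of_nonneg_left hsτ (by positivity)
  rcases le_total t τ with htτ | htτ
  · linarith [hfirst t ht htτ]
  have hττ : τ ∈ Icc 0 T := ⟨hτ.le, htτ.trans ht.2⟩
  have hmem : ∀ s ∈ Icc τ t, s ∈ Icc 0 T := fun s hs => ⟨hτ.le.trans hs.1, hs.2.trans ht.2⟩
  have := image_norm_le_of_norm_deriv_right_le_deriv_boundary' (f := fun s => w s - w 0) (f' := v)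
    (a := τ) (b := t)
    (B := fun s => M * τ ^ 2 + N / (β - 2) * (τ ^ (2 - β) - s ^ (2 - β)))
    (B' := fun s => N * s ^ (1 - β)) ?_ ?_ ?_ ?_ ?_ ?_ ⟨htτ, le_rfl⟩
  · refine this.trans ?_
    have h3 : 0 ≤ t ^ (2 - β) := Real.rpow_nonneg ht.1 _
    have h4 : 0 ≤ N / (β - 2) * t ^ (2 - β) := by positivity
    have : N * τ ^ (2 - β) / (β - 2) = N / (β - 2) * τ ^ (2 - β) := by ring
    rw [this, mul_sub]
    linarith
  · intro s hs
    exact ((hw s (hmem s hs)).continuousWithinAt.mono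
      (fun z hz => hτ.le.trans hz.1)).sub continuousWithinAt_const
  · intro s hs
    exact ((hw s (hmem s ⟨hs.1, hs.2.le⟩)).mono fun z hz => (hτ.le.trans hs.1).trans hz).sub_const _
  · simpa using hfirst τ hττ le_rfl
  · intro s hs
    have hs0 : s ≠ 0 := (hτ.trans_le hs.1).ne'
    exact (((continuousAt_const.sub (Real.continuousAt_rpow_const _ _ (Or.inl hs0))).const_mul
      _).const_add _).continuousWithinAt
  · intro s hs
    have hs0 : 0 < s := hτ.trans_le hs.1
    have h3 := (((Real.hasDerivAt_rpow_const (p := 2 - β) (Or.inl hs0.ne')).const_sub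
      (τ ^ (2 - β))).const_mul (N / (β - 2))).const_add (M * τ ^ 2)
    refine (h3.congr_deriv ?_).hasDerivWithinAt
    rw [show 2 - β - 1 = 1 - β by ring]
    field_simp
    ring
  · intro s hs
    exact h2 s ⟨hτ.trans_le hs.1, hs.2.le.trans ht.2⟩

end Displacement

theorem AbsolutelyContinuousOnInterval.finset_sum {ι E : Type*} [NormedAddCommGroup E]
    {f : ι → ℝ → E} {a b : ℝ} (s : Finset ι)
    (hf : ∀ i ∈ s, AbsolutelyContinuousOnInterval (f i) a b) :
    AbsolutelyContinuousOnInterval (fun t => ∑ i ∈ s, f i t) a b := by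
  classical
  induction s using Finset.induction_on with
  | empty =>
    simpa using (LipschitzWith.const (0 : E)).lipschitzOnWith.absolutelyContinuousOnInterval
  | insert i s hi ih =>
    simp only [Finset.sum_insert hi]
    exact (hf i (Finset.mem_insert_self i s)).fun_add
      (ih fun j hj => hf j (Finset.mem_insert_of_mem hj))

/-! ### The chain rule at the kink. -/

section Relu

theorem abs_relu_sub_relu_le (y z : ℝ) : |relu y - relu z| ≤ |y - z| := by
  simpa [relu] using abs_max_sub_max_le_abs y z 0

theorem relu_eq_add_relu_neg (z : ℝ) : relu z = z + relu (-z) := by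
  simp only [relu]
  rcases le_total z 0 with h | h
  · rw [max_eq_right h, max_eq_left (by linarith)]; ring
  · rw [max_eq_left h, max_eq_right (by linarith)]; ring

/-- The chain rule for the ReLU, with any admissible slope, wherever the composition is
differentiable. -/
theorem hasDerivAt_relu_comp {f : ℝ → ℝ} {f' t s : ℝ} (hf : HasDerivAt f f' t)
    (hd : DifferentiableAt ℝ (fun τ => relu (f τ)) t) (hs : s ∈ reluSlope (f t)) :
    HasDerivAt (fun τ => relu (f τ)) (s * f') t := by
  rcases lt_trichotomy (f t) 0 with h | h | h
  · rw [hs.2.1 h, zero_mul]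
    refine (hasDerivAt_const t (0 : ℝ)).congr_of_eventuallyEq ?_
    filter_upwards [hf.continuousAt.eventually_lt_const h] with τ hτ
    exact max_eq_right hτ.le
  -- At a zero of `g` the function `relu ∘ g` is minimal, so its derivative vanishes. Using this for
  -- `f` and `-f`, linked by `relu z = z + relu (-z)`, forces `f' = 0` and the slope becomes
  -- irrelevant.
  · have hmin : ∀ g : ℝ → ℝ, g t = 0 → IsLocalMin (fun τ => relu (g τ)) t := fun g hg =>
      Eventually.of_forall fun τ => by
        change relu (g t) ≤ relu (g τ)
        rw [hg]; simp [relu]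
    have h1 : deriv (fun τ => relu (f τ)) t = 0 := (hmin f h).deriv_eq_zero
    have h2 : HasDerivAt (fun τ => relu (f τ)) 0 t := h1 ▸ hd.hasDerivAt
    have h3 : HasDerivAt (fun τ => relu (-f τ)) (0 - f') t := by
      refine (h2.sub hf).congr_of_eventuallyEq (Eventually.of_forall fun τ => ?_)
      simp only [Pi.sub_apply]
      rw [relu_eq_add_relu_neg (f τ)]; ring
    have h4 := (hmin (fun τ => -f τ) (by simp [h])).hasDerivAt_eq_zero h3
    have h5 : f' = 0 := by linarith
    rwa [h5, mul_zero]
  · rw [hs.1 h, one_mul]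
    refine hf.congr_of_eventuallyEq ?_
    filter_upwards [hf.continuousAt.eventually_const_lt h] with τ hτ
    exact max_eq_left hτ.le

end Relu

/-! ### Right inverse of the initial Jacobian. -/

section Linear

variable {U X : Type*} [NormedAddCommGroup U] [InnerProductSpace ℝ U] [NormedAddCommGroup X]
  [InnerProductSpace ℝ X] [FiniteDimensional ℝ U] [CompleteSpace X]

/-- The Moore-Penrose right inverse of an operator whose adjoint is bounded below. -/
theorem exists_rightInverse_norm_le [CompleteSpace U] (A : X →L[ℝ] U) {c : ℝ} (hc : 0 < c)
    (h : ∀ z, c * ‖z‖ ^ 2 ≤ ‖A.adjoint z‖ ^ 2) :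
    ∃ Q : U →L[ℝ] X, (∀ z, A (Q z) = z) ∧ (∀ z, ‖Q z‖ ≤ (√c)⁻¹ * ‖z‖) ∧
      ∀ p, ⟪Q (A p), p⟫ ≤ ‖p‖ ^ 2 := by
  set H : U →ₗ[ℝ] U := (A ∘L A.adjoint).toLinearMap with hH
  have hHz : ∀ z, ⟪H z, z⟫ = ‖A.adjoint z‖ ^ 2 := by
    intro z
    rw [← real_inner_self_eq_norm_sq, ContinuousLinearMap.adjoint_inner_left]
    exact real_inner_comm _ _
  have hinj : Function.Injective H := by
    rw [← LinearMap.ker_eq_bot, LinearMap.ker_eq_bot']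
    intro z hz
    have h1 := hHz z
    rw [hz, inner_zero_left] at h1
    have h2 := h z
    rw [← h1] at h2
    have : ‖z‖ ^ 2 ≤ 0 := by nlinarith
    simpa using this
  set e := LinearEquiv.ofInjectiveEndo H hinj
  set S : U →L[ℝ] U := e.symm.toLinearMap.toContinuousLinearMap
  have hS : ∀ z, A (A.adjoint (S z)) = z := fun z => e.apply_symm_apply z
  -- `Q = Aᵀ (A Aᵀ)⁻¹`, so `Q A` is the orthogonal projection onto the range of `Aᵀ`; hence the last
  -- bound has constant 1.
  refine ⟨A.adjoint ∘L S, hS, fun z => ?_, fun p => ?_⟩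
  · change ‖A.adjoint (S z)‖ ≤ _
    have h1 : ‖A.adjoint (S z)‖ ^ 2 ≤ ‖z‖ * ‖S z‖ := by
      rw [← hHz]
      change ⟪A (A.adjoint (S z)), S z⟫ ≤ _
      rw [hS]; exact real_inner_le_norm _ _
    have h2 : √c * ‖S z‖ ≤ ‖A.adjoint (S z)‖ := by
      refine le_of_sq_le_sq ?_ (norm_nonneg _)
      rw [mul_pow, Real.sq_sqrt hc.le]; exact h _
    have hsc : 0 < √c := Real.sqrt_pos.2 hc
    rw [inv_mul_eq_div, le_div_iff₀ hsc]
    rcases (norm_nonneg (A.adjoint (S z))).eq_or_lt with h0 | h0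
    · rw [← h0]; simp
    · refine le_of_mul_le_mul_right ?_ h0
      nlinarith [norm_nonneg z, mul_le_mul_of_nonneg_left h2 (norm_nonneg z)]
  · change ⟪A.adjoint (S (A p)), p⟫ ≤ _
    have h1 : ⟪A.adjoint (S (A p)), p⟫ = ‖A.adjoint (S (A p))‖ ^ 2 := by
      rw [← hHz, ContinuousLinearMap.adjoint_inner_left]
      change _ = ⟪A (A.adjoint (S (A p))), _⟫
      rw [hS, real_inner_comm]
    have h2 := real_inner_le_norm (A.adjoint (S (A p))) p
    rw [h1] at h2 ⊢
    nlinarith [sq_nonneg (‖A.adjoint (S (A p))‖ - ‖p‖)]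

end Linear

/-! ### The network Jacobian and its perturbation under gate changes. -/

section Jacobian

variable {n m p : ℕ}

/-- The Hilbert space of all weights. -/
abbrev WeightSpace (m p : ℕ) := PiLp 2 (fun _ : Fin m => EuclideanSpace ℝ (Fin p))

noncomputable instance : NormedAddCommGroup (WeightSpace m p) := inferInstance

noncomputable instance : NormedSpace ℝ (WeightSpace m p) := inferInstance

instance : IsBoundedSMul ℝ (WeightSpace m p) := NormedSpace.toIsBoundedSMul

instance : ContinuousSMul ℝ (WeightSpace m p) := IsBoundedSMul.continuousSMul

/-- A family of weights as an element of the Hilbert space of all weights. -/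
noncomputable def stack (V : Fin m → EuclideanSpace ℝ (Fin p)) : WeightSpace m p :=
  WithLp.toLp 2 V

/-- The Jacobian of the network outputs on the training set with activation slopes `s`. -/
noncomputable def jacobian (x : Fin n → EuclideanSpace ℝ (Fin p)) (a : Fin m → ℝ)
    (s : Fin m → Fin n → ℝ) :
    WeightSpace m p →L[ℝ] EuclideanSpace ℝ (Fin n) :=
  (PiLp.continuousLinearEquiv 2 ℝ fun _ : Fin n => ℝ).symm.toContinuousLinearMap ∘L
    ContinuousLinearMap.pi fun i => (1 / √(m : ℝ)) • ∑ r, (a r * s r i) •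
      (innerSL ℝ (x i) ∘L PiLp.proj 2 (fun _ : Fin m => EuclideanSpace ℝ (Fin p)) r)

theorem jacobian_apply (x : Fin n → EuclideanSpace ℝ (Fin p)) (a : Fin m → ℝ)
    (s : Fin m → Fin n → ℝ) (v : WeightSpace m p) (i : Fin n) :
    jacobian x a s v i = 1 / √(m : ℝ) * ∑ r, a r * (s r i * ⟪v r, x i⟫) := by
  simp [jacobian, mul_assoc, real_inner_comm]

theorem jacobian_adjoint_apply (x : Fin n → EuclideanSpace ℝ (Fin p)) (a : Fin m → ℝ)
    (s : Fin m → Fin n → ℝ) (z : EuclideanSpace ℝ (Fin n)) :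
    (jacobian x a s).adjoint z =
      stack fun r => ∑ i, (z i * (1 / √(m : ℝ) * a r * s r i)) • x i := by
  refine ext_inner_right ℝ fun v => ?_
  rw [ContinuousLinearMap.adjoint_inner_left]
  rw [PiLp.inner_apply, PiLp.inner_apply]
  simp only [stack, jacobian_apply, sum_inner, real_inner_smul_left, RCLike.inner_apply, conj_trivial]
  rw [Finset.sum_comm]
  refine Finset.sum_congr rfl fun i _ => ?_
  rw [Finset.mul_sum, Finset.sum_mul]
  refine Finset.sum_congr rfl fun r _ => ?_
  rw [real_inner_comm (v r)]; ring

theorem jacobian_sub (x : Fin n → EuclideanSpace ℝ (Fin p)) (a : Fin m → ℝ)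
    (s s' : Fin m → Fin n → ℝ) : jacobian x a (s - s') = jacobian x a s - jacobian x a s' := by
  ext v i
  simp only [jacobian_apply, sub_apply, PiLp.sub_apply, Pi.sub_apply, ← mul_sub,
    ← Finset.sum_sub_distrib, sub_mul]

/-- Cauchy–Schwarz over the neurons, one output at a time. Applied to a difference of slopes, it
charges only the gates that changed. -/
theorem sq_norm_jacobian_le {x : Fin n → EuclideanSpace ℝ (Fin p)} (hx : ∀ i, ‖x i‖ = 1)
    {a : Fin m → ℝ} (ha : ∀ r, a r ^ 2 = 1) (s : Fin m → Fin n → ℝ)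
    (v : WeightSpace m p) :
    ‖jacobian x a s v‖ ^ 2 ≤ (∑ i, ∑ r, s r i ^ 2) / m * ‖v‖ ^ 2 := by
  rw [EuclideanSpace.norm_sq_eq, PiLp.norm_sq_eq_of_L2, Finset.sum_div, Finset.sum_mul]
  refine Finset.sum_le_sum fun i _ => ?_
  rw [jacobian_apply, Real.norm_eq_abs, sq_abs, mul_pow, div_pow, one_pow,
    Real.sq_sqrt (Nat.cast_nonneg m), one_div_mul_eq_div, div_mul_eq_mul_div]
  gcongr
  calc (∑ r, a r * (s r i * ⟪v r, x i⟫)) ^ 2 = (∑ r, s r i * (a r * ⟪v r, x i⟫)) ^ 2 := by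
        congr 1; exact Finset.sum_congr rfl fun r _ => by ring
    _ ≤ (∑ r, s r i ^ 2) * ∑ r, (a r * ⟪v r, x i⟫) ^ 2 := Finset.sum_mul_sq_le_sq_mul_sq _ _ _
    _ ≤ _ := by
        refine mul_le_mul_of_nonneg_left (Finset.sum_le_sum fun r _ => ?_)
          (Finset.sum_nonneg fun r _ => sq_nonneg _)
        rw [mul_pow, ha, one_mul, ← sq_abs]
        have := abs_real_inner_le_norm (v r) (x i)
        rw [hx, mul_one] at this
        gcongr

theorem norm_jacobian_sub_le {x : Fin n → EuclideanSpace ℝ (Fin p)} (hx : ∀ i, ‖x i‖ = 1)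
    {a : Fin m → ℝ} (ha : ∀ r, a r ^ 2 = 1) {c : ℝ} (hc : 0 < c) {s s₀ : Fin m → Fin n → ℝ}
    (hD : (∑ i, ∑ r, (s - s₀) r i ^ 2) / m ≤ c / 36) (v : WeightSpace m p) :
    ‖jacobian x a (s - s₀) v‖ ≤ √c / 6 * ‖v‖ := by
  refine le_of_sq_le_sq ((sq_norm_jacobian_le hx ha _ v).trans ?_) (by positivity)
  rw [mul_pow, div_pow, Real.sq_sqrt hc.le]
  exact mul_le_mul_of_nonneg_right (hD.trans_eq (by norm_num)) (sq_nonneg _)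

theorem jacobian_apply_eq_add (x : Fin n → EuclideanSpace ℝ (Fin p)) (a : Fin m → ℝ)
    (s s₀ : Fin m → Fin n → ℝ) (v : WeightSpace m p) :
    jacobian x a s v = jacobian x a s₀ v + jacobian x a (s - s₀) v := by
  rw [jacobian_sub, sub_apply, add_sub_cancel]

/-- `Q J₀` contributes at most `‖v‖²` and the perturbation a factor `(√c)⁻¹ · √c/6 = 1/6`. The same
split yields `5/6` in `le_inner_rightInverse_adjoint`. -/
theorem inner_rightInverse_jacobian_le {x : Fin n → EuclideanSpace ℝ (Fin p)}
    (hx : ∀ i, ‖x i‖ = 1) {a : Fin m → ℝ} (ha : ∀ r, a r ^ 2 = 1) {c : ℝ} (hc : 0 < c)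
    {s s₀ : Fin m → Fin n → ℝ} {Q : EuclideanSpace ℝ (Fin n) →L[ℝ] WeightSpace m p}
    (hQ : ∀ z, ‖Q z‖ ≤ (√c)⁻¹ * ‖z‖) (hQ' : ∀ v, ⟪Q (jacobian x a s₀ v), v⟫ ≤ ‖v‖ ^ 2)
    (hD : (∑ i, ∑ r, (s - s₀) r i ^ 2) / m ≤ c / 36) (v : WeightSpace m p) :
    ⟪Q (jacobian x a s v), v⟫ ≤ 7 / 6 * ‖v‖ ^ 2 := by
  have hsc : 0 < √c := Real.sqrt_pos.2 hc
  rw [jacobian_apply_eq_add x a s s₀, map_add, inner_add_left]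
  have h5 := hQ' v
  have h6 : ⟪Q (jacobian x a (s - s₀) v), v⟫ ≤ 1 / 6 * ‖v‖ * ‖v‖ := by
    refine (real_inner_le_norm _ _).trans (mul_le_mul_of_nonneg_right ?_ (norm_nonneg _))
    refine (hQ _).trans ((mul_le_mul_of_nonneg_left (norm_jacobian_sub_le hx ha hc hD v)
      (by positivity)).trans_eq ?_)
    field_simp
  linarith

theorem le_inner_rightInverse_adjoint {x : Fin n → EuclideanSpace ℝ (Fin p)}
    (hx : ∀ i, ‖x i‖ = 1) {a : Fin m → ℝ} (ha : ∀ r, a r ^ 2 = 1) {c : ℝ} (hc : 0 < c)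
    {s s₀ : Fin m → Fin n → ℝ} {Q : EuclideanSpace ℝ (Fin n) →L[ℝ] WeightSpace m p}
    (hQ' : ∀ z, jacobian x a s₀ (Q z) = z) (hQ : ∀ z, ‖Q z‖ ≤ (√c)⁻¹ * ‖z‖)
    (hD : (∑ i, ∑ r, (s - s₀) r i ^ 2) / m ≤ c / 36) (u : EuclideanSpace ℝ (Fin n)) :
    5 / 6 * ‖u‖ ^ 2 ≤ ⟪Q u, (jacobian x a s).adjoint u⟫ := by
  have hsc : 0 < √c := Real.sqrt_pos.2 hc
  rw [ContinuousLinearMap.adjoint_inner_right, jacobian_apply_eq_add x a s s₀, hQ', inner_add_left,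
    real_inner_self_eq_norm_sq]
  have h6 : |⟪jacobian x a (s - s₀) (Q u), u⟫| ≤ 1 / 6 * ‖u‖ * ‖u‖ := by
    refine (abs_real_inner_le_norm _ _).trans (mul_le_mul_of_nonneg_right ?_ (norm_nonneg _))
    refine (norm_jacobian_sub_le hx ha hc hD _).trans
      ((mul_le_mul_of_nonneg_left (hQ u) (by positivity)).trans_eq ?_)
    field_simp
  linarith [(abs_le.1 h6).1]

end Jacobian

/-! ### Which gates can change. -/

section Patterns

variable {n m p : ℕ}

open Classical in
/-- The indicator `𝕀{⟪w, x⟫ ≥ 0}`. -/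
noncomputable def gate (w x : EuclideanSpace ℝ (Fin p)) : ℝ := if 0 ≤ ⟪w, x⟫ then 1 else 0

/-- The activation pattern `𝕀{⟪wᵣ, xᵢ⟫ ≥ 0}`. -/
noncomputable def pattern (x : Fin n → EuclideanSpace ℝ (Fin p))
    (W : Fin m → EuclideanSpace ℝ (Fin p)) (r : Fin m) (i : Fin n) : ℝ := gate (W r) (x i)

open Classical in
/-- The number of pairs `(i, r)` with `|⟪wᵣ, xᵢ⟫| ≤ R`. -/
noncomputable def nearKink (x : Fin n → EuclideanSpace ℝ (Fin p))
    (W : Fin m → EuclideanSpace ℝ (Fin p)) (R : ℝ) : ℝ :=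
  ∑ i, ∑ r, if |⟪W r, x i⟫| ≤ R then 1 else 0

/-- A preactivation moves by at most `R`, so if it started outside `[-R, R]` it keeps its sign and
its slope equals the initial gate. Every other pair contributes at most 1. -/
theorem sum_sq_slope_sub_pattern_le {x : Fin n → EuclideanSpace ℝ (Fin p)} (hx : ∀ i, ‖x i‖ = 1)
    {W W' : Fin m → EuclideanSpace ℝ (Fin p)} {R : ℝ} (hR : ∀ r, ‖W' r - W r‖ ≤ R)
    {s : Fin m → Fin n → ℝ} (hs : ∀ r i, s r i ∈ reluSlope ⟪W' r, x i⟫) :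
    ∑ i, ∑ r, (s - pattern x W) r i ^ 2 ≤ nearKink x W R := by
  refine Finset.sum_le_sum fun i _ => Finset.sum_le_sum fun r _ => ?_
  have h1 : |⟪W' r, x i⟫ - ⟪W r, x i⟫| ≤ R := by
    rw [← inner_sub_left]
    have := abs_real_inner_le_norm (W' r - W r) (x i)
    rw [hx, mul_one] at this
    exact this.trans (hR r)
  obtain ⟨h2, h3, h4, h5⟩ := hs r i
  simp only [Pi.sub_apply, pattern, gate]
  rw [abs_le] at h1
  split_ifs with h6 h7 h7
  · nlinarith
  · rw [abs_of_nonneg h6] at h7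
    rw [h2 (by linarith)]; norm_num
  · nlinarith
  · rw [abs_of_neg (not_le.1 h6)] at h7
    rw [h3 (by linarith)]; norm_num

end Patterns

theorem hasDerivAt_toLp {ι : Type*} [Fintype ι] {E : ι → Type*} [∀ i, NormedAddCommGroup (E i)]
    [∀ i, NormedSpace ℝ (E i)] {f : ℝ → ∀ i, E i} {f' : PiLp 2 E} {t : ℝ}
    (hf : ∀ i, HasDerivAt (fun t => f t i) (f' i) t) :
    HasDerivAt (fun t => WithLp.toLp 2 (f t)) f' t :=
  (PiLp.continuousLinearEquiv 2 ℝ E).symm.toContinuousLinearMap.hasFDerivAt.comp_hasDerivAt t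
    (hasDerivAt_pi.2 hf)

/-! ### The Nesterov flow and the bootstrap. -/

section Flow

variable {n m p : ℕ} {γ : ℝ} {x : Fin n → EuclideanSpace ℝ (Fin p)} {y : Fin n → ℝ}
  {a : Fin m → ℝ} {W₀ : Fin m → EuclideanSpace ℝ (Fin p)}
  {W V : ℝ → Fin m → EuclideanSpace ℝ (Fin p)}

/-- The vector of residuals `f(W, a, xᵢ) - yᵢ`. -/
noncomputable def residuals (x : Fin n → EuclideanSpace ℝ (Fin p)) (y : Fin n → ℝ)
    (W : Fin m → EuclideanSpace ℝ (Fin p)) (a : Fin m → ℝ) : EuclideanSpace ℝ (Fin n) :=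
  WithLp.toLp 2 fun i => network W a (x i) - y i

theorem sq_norm_residuals (W : Fin m → EuclideanSpace ℝ (Fin p)) :
    ‖residuals x y W a‖ ^ 2 = 2 * loss x y W a := by
  rw [EuclideanSpace.norm_sq_eq, loss]
  simp only [residuals, Real.norm_eq_abs, sq_abs]
  ring

namespace IsNesterovFlow

theorem absolutelyContinuous_pos (h : IsNesterovFlow γ x y a W₀ W V) {b c : ℝ} (hb : 0 ≤ b)
    (hbc : b ≤ c) (r : Fin m) : AbsolutelyContinuousOnInterval (fun t => W t r) b c := by
  have hsub : Icc b c ⊆ Ici 0 := fun t ht => hb.trans ht.1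
  obtain ⟨C, hC⟩ := isCompact_Icc.exists_bound_of_continuousOn ((h.continuous_vel r).mono hsub)
  have hL : LipschitzOnWith C.toNNReal (fun t => W t r) (Icc b c) :=
    (convex_Icc b c).lipschitzOnWith_of_nnnorm_hasDerivWithin_le (f' := fun t => V t r)
      (fun t ht => (h.hasDeriv r t (hsub ht)).mono hsub)
      (fun t ht => NNReal.coe_le_coe.1 ((hC t ht).trans (Real.le_coe_toNNReal C)))
  rw [← uIcc_of_le hbc] at hL
  exact hL.absolutelyContinuousOnInterval

theorem absolutelyContinuous_relu (h : IsNesterovFlow γ x y a W₀ W V) {b c : ℝ} (hb : 0 ≤ b)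
    (hbc : b ≤ c) (r : Fin m) (i : Fin n) :
    AbsolutelyContinuousOnInterval (fun t => relu ⟪W t r, x i⟫) b c := by
  refine ((h.absolutelyContinuous_pos hb hbc r).clm_comp (innerSL ℝ (x i))).of_dist_le (C := 1)
    fun s _ t _ => ?_
  rw [one_mul, Real.dist_eq, Real.dist_eq]
  simpa only [innerSL_apply_apply, real_inner_comm (x i)] using abs_relu_sub_relu_le _ _

theorem absolutelyContinuous_residuals (h : IsNesterovFlow γ x y a W₀ W V) {b c : ℝ} (hb : 0 ≤ b)
    (hbc : b ≤ c) : AbsolutelyContinuousOnInterval (fun t => residuals x y (W t) a) b c := by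
  refine AbsolutelyContinuousOnInterval.piLp fun i => ?_
  exact ((AbsolutelyContinuousOnInterval.finset_sum _ fun r _ =>
    (h.absolutelyContinuous_relu hb hbc r i).const_mul (a r)).const_mul _).fun_sub
    (LipschitzWith.const (y i)).lipschitzOnWith.absolutelyContinuousOnInterval

/-- One and the same `s` must serve in both equations, since energy conservation up to friction
rests on `J` and its adjoint being paired. -/
theorem ae_hasDerivAt (h : IsNesterovFlow γ x y a W₀ W V) {T : ℝ} (hT : 0 ≤ T) :
    ∀ᵐ t, t ∈ Ioo 0 T → ∃ s : Fin m → Fin n → ℝ, (∀ r i, s r i ∈ reluSlope ⟪W t r, x i⟫) ∧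
      HasDerivAt (fun τ => residuals x y (W τ) a) (jacobian x a s (stack (V t))) t ∧
      HasDerivAt (fun τ => stack (V τ))
        (-((γ / t) • stack (V t)) -
          (jacobian x a s).adjoint (residuals x y (W t) a)) t := by
  have hd : ∀ᵐ t, ∀ r i, t ∈ uIcc 0 T → DifferentiableAt ℝ (fun τ => relu ⟪W τ r, x i⟫) t := by
    rw [ae_all_iff]; intro r
    rw [ae_all_iff]; intro i
    exact (h.absolutelyContinuous_relu le_rfl hT r i).ae_differentiableAt
  have he := (ae_restrict_iff' measurableSet_Ioi).1 h.equation
  filter_upwards [hd, he] with t h1 h2 ht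
  obtain ⟨g, ⟨s, hs, hg⟩, h3⟩ := h2 ht.1
  have hV : ∀ r, HasDerivAt (fun τ => W τ r) (V t r) t := fun r =>
    (h.hasDeriv r t ht.1.le).hasDerivAt (Ici_mem_nhds ht.1)
  refine ⟨s, hs, ?_, ?_⟩
  · refine hasDerivAt_toLp fun i => ?_
    rw [jacobian_apply]
    refine ((HasDerivAt.fun_sum fun r _ => ?_).const_mul _).sub_const _
    refine HasDerivAt.const_mul (a r) (hasDerivAt_relu_comp ?_ (h1 r i ?_) (hs r i))
    · exact ((hV r).inner ℝ (hasDerivAt_const t (x i))).congr_deriv (by simp [stack])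
    · rw [uIcc_of_le hT]; exact ⟨ht.1.le, ht.2.le⟩
  · refine hasDerivAt_toLp fun r => ?_
    rw [jacobian_adjoint_apply]
    exact (h3 r).congr_deriv (by rw [hg r]; rfl)

theorem continuousOn_residuals (h : IsNesterovFlow γ x y a W₀ W V) {T : ℝ} (hT : 0 ≤ T) :
    ContinuousOn (fun t => residuals x y (W t) a) (Icc 0 T) := by
  have := (h.absolutelyContinuous_residuals le_rfl hT).continuousOn
  rwa [uIcc_of_le hT] at this

theorem continuousOn_stack_vel (h : IsNesterovFlow γ x y a W₀ W V) (T : ℝ) :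
    ContinuousOn (fun t => stack (V t))
      (Icc 0 T) :=
  (PiLp.continuousLinearEquiv 2 ℝ fun _ => EuclideanSpace ℝ (Fin p)).symm.continuous.comp_continuousOn
    (continuousOn_pi.2 fun r => (h.continuous_vel r).mono fun _ ht => ht.1)

/-- Holds without any closeness to initialization; it controls the speed at early times. -/
theorem sq_norm_residuals_le (h : IsNesterovFlow γ x y a W₀ W V) (hγ : 0 ≤ γ) {t : ℝ}
    (ht : 0 ≤ t) : ‖residuals x y (W t) a‖ ^ 2 ≤ ‖residuals x y (W 0) a‖ ^ 2 := by
  have := energy_le hγ (h.continuousOn_residuals ht) (h.continuousOn_stack_vel t)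
    (fun b c hb hbc _ => h.absolutelyContinuous_residuals hb.le hbc)
    (fun b c hb hbc _ => AbsolutelyContinuousOnInterval.piLp fun r => h.absCont_vel r b c hb hbc)
    ((h.ae_hasDerivAt ht).mono fun τ h1 h2 => by
      obtain ⟨s, -, h3, h4⟩ := h1 h2
      exact ⟨_, _, h3, h4, (ContinuousLinearMap.adjoint_inner_left _ _ _).symm⟩) ⟨ht, le_rfl⟩
  have h0 : stack (V 0) = 0 := by rw [h.init_vel]; rfl
  rw [h0, norm_zero] at this
  nlinarith [sq_nonneg ‖stack (V t)‖]

theorem sq_norm_residuals_le_rpow (h : IsNesterovFlow γ x y a W₀ W V) (hx : ∀ i, ‖x i‖ = 1)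
    (ha : ∀ r, a r ^ 2 = 1) {α c R T t : ℝ} (hγ : 0 < γ) (hα : 0 < α) (hαγ : α ≤ 2 * γ / 3)
    (hc : 0 < c)
    (hgram : ∀ z, c * ‖z‖ ^ 2 ≤ ‖(jacobian x a (pattern x W₀)).adjoint z‖ ^ 2)
    (hkink : nearKink x W₀ R / m ≤ c / 36)
    (hclose : ∀ t ∈ Icc 0 T, ∀ r, ‖W t r - W₀ r‖ ≤ R) (ht : t ∈ Ioc 0 T) :
    ‖residuals x y (W t) a‖ ^ 2 ≤
      2 * (3 * (1 + γ + α) * (√c)⁻¹ / t) ^ α * ‖residuals x y (W 0) a‖ ^ 2 := by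
  obtain ⟨Q, hQ1, hQ2, hQ3⟩ := exists_rightInverse_norm_le _ hc hgram
  have hT : 0 ≤ T := ht.1.le.trans ht.2
  have hsc : 0 < √c := Real.sqrt_pos.2 hc
  have hp0 : stack (V 0) = 0 := by rw [h.init_vel]; rfl
  have hac : ∀ b c, 0 < b → b ≤ c → c ≤ T →
      AbsolutelyContinuousOnInterval (fun t => stack (V t)) b c := fun b c hb hbc _ =>
    AbsolutelyContinuousOnInterval.piLp fun r => h.absCont_vel r b c hb hbc
  refine sq_norm_le_rpow_mul (u := fun t => residuals x y (W t) a) (p := fun t => stack (V t))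
    (Q := Q) hγ hα hαγ (inv_pos.2 hsc) hQ2 (h.continuousOn_residuals hT)
    (h.continuousOn_stack_vel T) hp0
    (fun b c hb hbc _ => h.absolutelyContinuous_residuals hb.le hbc) hac ?_ ht
  filter_upwards [h.ae_hasDerivAt hT] with τ h1 h2
  obtain ⟨s, hs, h3, h4⟩ := h1 h2
  have hD : (∑ i, ∑ r, (s - pattern x W₀) r i ^ 2) / m ≤ c / 36 := by
    refine le_trans ?_ hkink
    gcongr
    exact sum_sq_slope_sub_pattern_le hx (hclose τ ⟨h2.1.le, h2.2.le⟩) hs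
  exact ⟨_, _, h3, h4, (ContinuousLinearMap.adjoint_inner_left _ _ _).symm,
    inner_rightInverse_jacobian_le hx ha hc hQ2 hQ3 hD _,
    le_inner_rightInverse_adjoint hx ha hc hQ1 hQ2 hD _⟩

/-- A single neuron feels a force of at most `√(n/m) ‖u‖`: this is where width makes each weight
slow. -/
theorem norm_vel_le (h : IsNesterovFlow γ x y a W₀ W V) (hx : ∀ i, ‖x i‖ = 1)
    (ha : ∀ r, a r ^ 2 = 1) {β M T t : ℝ} (hγ : 0 < γ) (hβ : β ≤ γ) (hM : 0 ≤ M)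
    (hres : ∀ t ∈ Ioc 0 T, ‖residuals x y (W t) a‖ ≤ M * t ^ (-β)) (r : Fin m)
    (ht : t ∈ Ioc 0 T) : ‖V t r‖ ≤ √(n / m) * M * t ^ (1 - β) := by
  have hT : 0 ≤ T := ht.1.le.trans ht.2
  have := norm_velocity_le (γ := γ) (β := β) (M := √(n / m) * M) (v := fun t => V t r)
    (by linarith) hγ (by positivity) ((h.continuous_vel r).mono fun _ ht => ht.1)
    (fun b c hb hbc _ => h.absCont_vel r b c hb hbc) ?_ ht
  · refine this.trans (div_le_self ?_ (by linarith))
    have := Real.rpow_nonneg ht.1.le (1 - β)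
    positivity
  filter_upwards [(ae_restrict_iff' measurableSet_Ioi).1 h.equation] with τ h1 hτ
  obtain ⟨g, ⟨s, hs, hg⟩, h2⟩ := h1 hτ.1
  refine ⟨g r, h2 r, ?_⟩
  rw [mul_assoc]
  refine le_trans ?_ (mul_le_mul_of_nonneg_left (hres τ ⟨hτ.1, hτ.2.le⟩) (Real.sqrt_nonneg _))
  set u := residuals x y (W τ) a with hu
  have har : |a r| = 1 := by
    have := ha r
    rw [← sq_abs] at this
    nlinarith [abs_nonneg (a r)]
  have h3 : ‖g r‖ ≤ 1 / √m * ∑ i, |u i| := by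
    rw [hg r, Finset.mul_sum]
    refine (norm_sum_le _ _).trans (Finset.sum_le_sum fun i _ => ?_)
    rw [norm_smul, hx, mul_one, norm_mul, norm_mul, norm_mul]
    simp only [Real.norm_eq_abs, har]
    have hs1 : |s r i| ≤ 1 := by
      rw [abs_of_nonneg (hs r i).2.2.1]; exact (hs r i).2.2.2
    rw [abs_of_nonneg (by positivity : 0 ≤ 1 / √(m : ℝ)), mul_one, mul_comm]
    change _ * |u i| ≤ _
    refine mul_le_mul_of_nonneg_right ?_ (abs_nonneg _)
    exact mul_le_of_le_one_right (by positivity) hs1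
  have h4 : ∑ i, |u i| ≤ √n * ‖u‖ := by
    refine le_of_sq_le_sq ?_ (by positivity)
    have := Finset.sum_mul_sq_le_sq_mul_sq Finset.univ (fun _ : Fin n => (1 : ℝ)) fun i => |u i|
    rw [mul_pow, Real.sq_sqrt (Nat.cast_nonneg n), EuclideanSpace.norm_sq_eq]
    simpa using this
  calc ‖g r‖ ≤ 1 / √m * (√n * ‖u‖) := h3.trans (mul_le_mul_of_nonneg_left h4 (by positivity))
    _ = √(n / m) * ‖u‖ := by rw [Real.sqrt_div (Nat.cast_nonneg n)]; ring

/-- If the weights move by at most `R` they in fact move by less. -/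
theorem norm_pos_sub_le (h : IsNesterovFlow γ x y a W₀ W V) (hx : ∀ i, ‖x i‖ = 1)
    (ha : ∀ r, a r ^ 2 = 1) {α c R T : ℝ} (hα : 4 < α) (hαγ : α ≤ 2 * γ / 3)
    (hc : 0 < c)
    (hgram : ∀ z, c * ‖z‖ ^ 2 ≤ ‖(jacobian x a (pattern x W₀)).adjoint z‖ ^ 2)
    (hkink : nearKink x W₀ R / m ≤ c / 36) (hT : 0 ≤ T)
    (hclose : ∀ t ∈ Icc 0 T, ∀ r, ‖W t r - W₀ r‖ ≤ R) (r : Fin m) :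
    ‖W T r - W₀ r‖ ≤ √(n / m) * ‖residuals x y (W 0) a‖ / c *
      (1 + √(2 * (3 * (1 + γ + α)) ^ α) / (α / 2 - 2)) := by
  have hγ : 0 < γ := by linarith
  have hsc : 0 < √c := Real.sqrt_pos.2 hc
  set M := ‖residuals x y (W 0) a‖ with hM
  set A := √(2 * (3 * (1 + γ + α)) ^ α) with hA
  have h1 : ∀ t ∈ Ioc 0 T, ‖V t r‖ ≤ √(n / m) * M * t := by
    intro t ht
    have := h.norm_vel_le hx ha (β := 0) (M := M) hγ hγ.le (norm_nonneg _)
      (fun s hs => by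
        simpa using abs_le_of_sq_le_sq' (h.sq_norm_residuals_le hγ.le hs.1.le) (norm_nonneg _) |>.2)
      r ht
    simpa using this
  have h2 : ∀ t ∈ Ioc 0 T, ‖V t r‖ ≤ √(n / m) * (A * ((√c)⁻¹) ^ (α / 2) * M) * t ^ (1 - α / 2) := by
    intro t ht
    refine h.norm_vel_le hx ha hγ (by linarith) (by positivity) (fun s hs => ?_) r ht
    have h3 := h.sq_norm_residuals_le_rpow hx ha hγ (by linarith) hαγ hc hgram hkink hclose hs
    have hs0 := hs.1
    refine le_of_sq_le_sq (h3.trans_eq ?_) (by positivity)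
    have e1 : ∀ z : ℝ, 0 ≤ z → (z ^ (α / 2)) ^ 2 = z ^ α := fun z hz => by
      rw [← Real.rpow_natCast, ← Real.rpow_mul hz]; congr 1; push_cast; ring
    rw [mul_pow, mul_pow, mul_pow, e1 _ (by positivity), Real.rpow_neg hs0.le, inv_pow, e1 _ hs0.le,
      hA, Real.sq_sqrt (by positivity), Real.div_rpow (by positivity) hs0.le,
      Real.mul_rpow (by positivity) (by positivity)]
    ring
  -- Cutting at `(√c)⁻¹` gives both time ranges the same order: the powers of `c` combine to `c⁻¹`
  -- in each.
  have h3 := norm_displacement_le (β := α / 2) (τ := (√c)⁻¹) (T := T) (t := T)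
    (w := fun t => W t r) (v := fun t => V t r) (by linarith)
    (by positivity : 0 ≤ √(n / m) * M) (by positivity) (inv_pos.2 hsc)
    (fun t ht => h.hasDeriv r t ht.1) (fun t ht => ?_) h2 ⟨hT, le_rfl⟩
  · simp only [h.init_pos] at h3
    refine h3.trans_eq ?_
    have e2 : ((√c)⁻¹) ^ (α / 2) * ((√c)⁻¹) ^ (2 - α / 2) = c⁻¹ := by
      rw [← Real.rpow_add (inv_pos.2 hsc), add_sub_cancel, Real.rpow_two, inv_pow,
        Real.sq_sqrt hc.le]
    rw [inv_pow, Real.sq_sqrt hc.le, show √(n / m) * (A * ((√c)⁻¹) ^ (α / 2) * M) *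
      ((√c)⁻¹) ^ (2 - α / 2) = √(n / m) * A * M * (((√c)⁻¹) ^ (α / 2) * ((√c)⁻¹) ^ (2 - α / 2))
      by ring, e2]
    ring
  · rcases ht.1.eq_or_lt with h0 | h0
    · rw [← h0, h.init_vel]; simp
    · exact h1 t ⟨h0, ht.2⟩

/-- Continuity argument: at the first time `T` at which some weight has moved by `R`, the bounds
valid up to `T` give a displacement strictly below `R`, a contradiction. -/
theorem loss_le (h : IsNesterovFlow γ x y a W₀ W V) (hx : ∀ i, ‖x i‖ = 1)
    (ha : ∀ r, a r ^ 2 = 1) {α c R t : ℝ} (hα : 4 < α) (hαγ : α ≤ 2 * γ / 3) (hc : 0 < c)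
    (hR0 : 0 < R)
    (hgram : ∀ z, c * ‖z‖ ^ 2 ≤ ‖(jacobian x a (pattern x W₀)).adjoint z‖ ^ 2)
    (hkink : nearKink x W₀ R / m ≤ c / 36)
    (hR : √(n / m) * √(2 * loss x y W₀ a) / c *
      (1 + √(2 * (3 * (1 + γ + α)) ^ α) / (α / 2 - 2)) < R) (ht : 0 < t) :
    loss x y (W t) a ≤
      2 * (3 * (1 + γ + α)) ^ α / c ^ (α / 2) * t ^ (-α) * loss x y (W 0) a := by
  have hγ : 0 < γ := by linarith
  rw [← h.init_pos, ← sq_norm_residuals, Real.sqrt_sq (norm_nonneg _)] at hR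
  have hclose : ∀ s ∈ Icc 0 t, ∀ r, ‖W s r - W₀ r‖ ≤ R := by
    by_contra hcon
    push Not at hcon
    obtain ⟨s₀, hs₀, r₀, hr₀⟩ := hcon
    -- The norm here is the sup norm over neurons, so `ψ` tracks the farthest weight.
    set ψ : ℝ → ℝ := fun s => ‖W s - W₀‖ with hψ
    have hcont : ContinuousOn ψ (Icc 0 s₀) :=
      ((continuousOn_pi.2 fun r s hs =>
        ((h.hasDeriv r s hs.1).continuousWithinAt.mono fun _ hz => hz.1)).sub
        continuousOn_const).norm
    set S := Icc 0 s₀ ∩ ψ ⁻¹' Ici R with hS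
    have hSc : IsCompact S :=
      isCompact_Icc.of_isClosed_subset (hcont.preimage_isClosed_of_isClosed isClosed_Icc isClosed_Ici)
        inter_subset_left
    have hSn : S.Nonempty :=
      ⟨s₀, ⟨hs₀.1, le_rfl⟩, hr₀.le.trans (norm_le_pi_norm (W s₀ - W₀) r₀)⟩
    obtain ⟨T, hTS, hTmin⟩ := hSc.exists_isLeast hSn
    have hT0 : 0 < T := by
      rcases hTS.1.1.eq_or_lt with h0 | h0
      · have := hTS.2
        rw [← h0] at this
        simp only [hψ, mem_preimage, h.init_pos, sub_self, norm_zero, mem_Ici] at this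
        linarith
      · exact h0
    have hlt : ∀ s ∈ Ico 0 T, ψ s ≤ R := by
      intro s hs
      by_contra hcon
      have := hTmin ⟨⟨hs.1, hs.2.le.trans hTS.1.2⟩, (not_le.1 hcon).le⟩
      linarith [hs.2]
    have hle : ∀ s ∈ Icc 0 T, ψ s ≤ R := by
      have h1 : ContinuousOn ψ (closure (Ico 0 T)) := by
        rw [closure_Ico hT0.ne]; exact hcont.mono (Icc_subset_Icc_right hTS.1.2)
      intro s hs
      rw [← closure_Ico hT0.ne] at hs
      exact le_on_closure hlt h1 continuousOn_const hs
    have h2 : ψ T ≤ √(n / m) * ‖residuals x y (W 0) a‖ / c *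
        (1 + √(2 * (3 * (1 + γ + α)) ^ α) / (α / 2 - 2)) := by
      refine (pi_norm_le_iff_of_nonneg ?_).2 fun r => ?_
      · have : 0 < α / 2 - 2 := by linarith
        positivity
      · exact h.norm_pos_sub_le hx ha hα hαγ hc hgram hkink hT0.le
          (fun s hs r => (norm_le_pi_norm (W s - W₀) r).trans (hle s hs)) r
    have h3 : R ≤ ψ T := hTS.2
    linarith
  have h1 := h.sq_norm_residuals_le_rpow hx ha hγ (by linarith) hαγ hc hgram hkink hclose
    ⟨ht, le_rfl⟩
  rw [sq_norm_residuals, sq_norm_residuals] at h1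
  have e1 : (√c) ^ α = c ^ (α / 2) := by
    rw [Real.sqrt_eq_rpow, ← Real.rpow_mul hc.le]; congr 1; ring
  rw [Real.div_rpow (by positivity) ht.le, Real.mul_rpow (by positivity) (by positivity),
    Real.inv_rpow (Real.sqrt_nonneg c), e1] at h1
  rw [Real.rpow_neg ht.le]
  refine le_of_mul_le_mul_left (h1.trans_eq ?_) two_pos
  ring

end IsNesterovFlow
end Flow

/-! ### Gates and the limiting Gram matrix. -/

section Gate

variable {p : ℕ}

theorem gate_nonneg (w x : EuclideanSpace ℝ (Fin p)) : 0 ≤ gate w x := by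
  unfold gate; split_ifs <;> norm_num

theorem gate_le_one (w x : EuclideanSpace ℝ (Fin p)) : gate w x ≤ 1 := by
  unfold gate; split_ifs <;> norm_num

theorem measurable_gate (x : EuclideanSpace ℝ (Fin p)) : Measurable fun w => gate w x := by
  unfold gate
  refine Measurable.ite (measurableSet_le measurable_const ?_) measurable_const measurable_const
  fun_prop

end Gate

section Gram

variable {n p : ℕ}

theorem gramInfty_apply (x : Fin n → EuclideanSpace ℝ (Fin p)) (i j : Fin n) :
    gramInfty x i j =
      ∫ w, gate w (x i) * gate w (x j) * ⟪x i, x j⟫ ∂stdGaussian (EuclideanSpace ℝ (Fin p)) := by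
  simp only [gramInfty, Matrix.of_apply, gate]
  congr 1
  ext w
  by_cases h1 : 0 ≤ ⟪w, x i⟫ <;> by_cases h2 : 0 ≤ ⟪w, x j⟫ <;> simp [h1, h2]

theorem integrable_gate_mul (x : Fin n → EuclideanSpace ℝ (Fin p)) (i j : Fin n) :
    Integrable (fun w => gate w (x i) * gate w (x j) * ⟪x i, x j⟫)
      (stdGaussian (EuclideanSpace ℝ (Fin p))) := by
  refine Integrable.of_bound (((measurable_gate _).mul (measurable_gate _)).mul_const
    _).aestronglyMeasurable |⟪x i, x j⟫| (Eventually.of_forall fun w => ?_)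
  rw [Real.norm_eq_abs, abs_mul, abs_of_nonneg (mul_nonneg (gate_nonneg _ _) (gate_nonneg _ _))]
  exact mul_le_of_le_one_left (abs_nonneg _)
    (mul_le_one₀ (gate_le_one _ _) (gate_nonneg _ _) (gate_le_one _ _))

theorem integrable_smul_gate_mul (x : Fin n → EuclideanSpace ℝ (Fin p)) (c : Fin n → ℝ)
    (i j : Fin n) :
    Integrable (fun w => c i * gate w (x i) * (c j * gate w (x j)) * ⟪x i, x j⟫)
      (stdGaussian (EuclideanSpace ℝ (Fin p))) := by
  refine ((integrable_gate_mul x i j).const_mul (c i * c j)).congr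
    (Eventually.of_forall fun w => ?_)
  simp only; ring

theorem isHermitian_gramInfty (x : Fin n → EuclideanSpace ℝ (Fin p)) :
    (gramInfty x).IsHermitian := by
  ext i j
  rw [Matrix.conjTranspose_apply, star_trivial, gramInfty_apply, gramInfty_apply]
  congr 1
  ext w
  rw [real_inner_comm]; ring

theorem sq_norm_sum_smul {ι E : Type*} [Fintype ι] [NormedAddCommGroup E] [InnerProductSpace ℝ E]
    (c : ι → ℝ) (x : ι → E) : ‖∑ i, c i • x i‖ ^ 2 = ∑ i, ∑ j, c i * c j * ⟪x i, x j⟫ := by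
  rw [← real_inner_self_eq_norm_sq, sum_inner]
  refine Finset.sum_congr rfl fun i _ => ?_
  rw [inner_sum]
  refine Finset.sum_congr rfl fun j _ => ?_
  rw [real_inner_smul_left, real_inner_smul_right]; ring

theorem dotProduct_gramInfty_mulVec (x : Fin n → EuclideanSpace ℝ (Fin p)) (z : Fin n → ℝ) :
    z ⬝ᵥ (gramInfty x).mulVec z = ∑ i, ∑ j, z i * z j * gramInfty x i j := by
  simp only [dotProduct, Matrix.mulVec, Finset.mul_sum]
  exact Finset.sum_congr rfl fun i _ => Finset.sum_congr rfl fun j _ => by ring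

theorem sum_gramInfty_eq_integral (x : Fin n → EuclideanSpace ℝ (Fin p)) (z : Fin n → ℝ) :
    ∑ i, ∑ j, z i * z j * gramInfty x i j =
      ∫ w, ‖∑ i, (z i * gate w (x i)) • x i‖ ^ 2 ∂stdGaussian (EuclideanSpace ℝ (Fin p)) := by
  simp only [sq_norm_sum_smul, gramInfty_apply]
  have hint := integrable_smul_gate_mul x z
  rw [integral_finsetSum _ fun i _ => integrable_finsetSum _ fun j _ => hint i j]
  refine Finset.sum_congr rfl fun i _ => ?_
  rw [integral_finsetSum _ fun j _ => hint i j]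
  refine Finset.sum_congr rfl fun j _ => ?_
  rw [← integral_const_mul]
  congr 1; ext w; ring

/-- Allows an almost sure identity to be evaluated at some point of any nonempty open set. -/
instance isOpenPosMeasure_stdGaussian :
    (stdGaussian (EuclideanSpace ℝ (Fin p))).IsOpenPosMeasure := by
  have : (gaussianReal 0 1).IsOpenPosMeasure :=
    (gaussianReal_absolutelyContinuous' 0 one_ne_zero).isOpenPosMeasure
  rw [← map_pi_eq_stdGaussian]
  exact (PiLp.continuousLinearEquiv 2 ℝ fun _ : Fin p => ℝ).symm.continuous.isOpenPosMeasure_map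
    (PiLp.continuousLinearEquiv 2 ℝ fun _ : Fin p => ℝ).symm.surjective

/-- A vector orthogonal to `x i` and to none of the other, non-parallel, vectors. -/
theorem exists_inner_eq_zero_forall_inner_ne_zero {ι E : Type*} [Finite ι] [NormedAddCommGroup E]
    [InnerProductSpace ℝ E] {x : ι → E} (i : ι)
    (hx : ∀ j, j ≠ i → LinearIndependent ℝ ![x i, x j]) :
    ∃ z, ⟪x i, z⟫ = 0 ∧ ∀ j, j ≠ i → ⟪x j, z⟫ ≠ 0 := by
  set S := (ℝ ∙ x i)ᗮ
  by_contra hcon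
  push Not at hcon
  -- Otherwise the hyperplane orthogonal to `x i` is a finite union of kernels, so one kernel is
  -- everything; then `x j` lies on the line of `x i`.
  have hcov : ⋃ j : {j // j ≠ i},
      (((innerSL ℝ (x j)).toLinearMap ∘ₗ S.subtype).ker : Set S) = univ := by
    refine eq_univ_of_forall fun z => ?_
    obtain ⟨j, hj, hjz⟩ := hcon z (Submodule.mem_orthogonal_singleton_iff_inner_right.1 z.2)
    exact mem_iUnion.2 ⟨⟨j, hj⟩, by simpa using hjz⟩
  obtain ⟨⟨j, hj⟩, htop⟩ := Subspace.exists_eq_top_of_iUnion_eq_univ hcov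
  have hmem : x j ∈ Sᗮ := by
    rw [Submodule.mem_orthogonal]
    intro u hu
    have : (⟨u, hu⟩ : S) ∈ ((innerSL ℝ (x j)).toLinearMap ∘ₗ S.subtype).ker := htop ▸ trivial
    rw [real_inner_comm]
    simpa using this
  rw [Submodule.orthogonal_orthogonal, Submodule.mem_span_singleton] at hmem
  obtain ⟨c, hc⟩ := hmem
  have := (LinearIndependent.pair_iff.1 (hx j hj)) c (-1) (by rw [hc]; simp)
  linarith [this.2]

/-- The quadratic form is the mean of `‖∑ cᵢ gateᵢ xᵢ‖²`; if it vanishes, the sum is almost surely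
0. Near a point orthogonal to `x i` alone, crossing that hyperplane flips only gate `i`, and
subtracting the two identities leaves `cᵢ xᵢ = 0`. -/
theorem posDef_gramInfty {x : Fin n → EuclideanSpace ℝ (Fin p)} (hx : ∀ i, ‖x i‖ = 1)
    (hxx : ∀ i j, i ≠ j → LinearIndependent ℝ ![x i, x j]) : (gramInfty x).PosDef := by
  refine Matrix.PosDef.of_dotProduct_mulVec_pos (isHermitian_gramInfty x) fun c hc => ?_
  rw [star_trivial, dotProduct_gramInfty_mulVec, sum_gramInfty_eq_integral]
  refine lt_of_le_of_ne (integral_nonneg fun w => sq_nonneg _) fun h0 => hc ?_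
  have hint : Integrable (fun w => ‖∑ i, (c i * gate w (x i)) • x i‖ ^ 2)
      (stdGaussian (EuclideanSpace ℝ (Fin p))) := by
    simp only [sq_norm_sum_smul]
    exact integrable_finsetSum _ fun i _ => integrable_finsetSum _ fun j _ =>
      integrable_smul_gate_mul x c i j
  have hae := (integral_eq_zero_iff_of_nonneg (fun w => sq_nonneg _) hint).1 h0.symm
  have hne : ∀ U : Set (EuclideanSpace ℝ (Fin p)), IsOpen U → U.Nonempty →
      ∃ w ∈ U, ∑ i, (c i * gate w (x i)) • x i = 0 := by
    intro U hU hUn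
    by_contra hcon
    push Not at hcon
    refine (hU.measure_pos (stdGaussian (EuclideanSpace ℝ (Fin p))) hUn).ne' ?_
    refine measure_mono_null (fun w hw => ?_) hae
    change ¬ (‖∑ i, (c i * gate w (x i)) • x i‖ ^ 2 = 0)
    simpa using hcon w hw
  ext i
  obtain ⟨z, hz, hzj⟩ := exists_inner_eq_zero_forall_inner_ne_zero (x := x) i
    fun j hj => hxx i j hj.symm
  set N : Set (EuclideanSpace ℝ (Fin p)) := ⋂ j, ⋂ _ : j ≠ i, {w | 0 < ⟪w, x j⟫ * ⟪z, x j⟫} with hN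
  have hNo : IsOpen N := isOpen_iInter_of_finite fun j => isOpen_iInter_of_finite fun _ =>
    isOpen_lt continuous_const (by fun_prop)
  have hzN : z ∈ N := mem_iInter₂.2 fun j hj => by
    have : ⟪z, x j⟫ ≠ 0 := by rw [real_inner_comm]; exact hzj j hj
    exact mul_self_pos.2 this
  have hdir : ∀ s : ℝ, s ≠ 0 → ∃ ε > 0, z + (ε * s) • x i ∈ N := by
    intro s hs
    have hcont : Continuous fun ε : ℝ => z + (ε * s) • x i := by fun_prop
    have : ∀ᶠ ε : ℝ in 𝓝 0, z + (ε * s) • x i ∈ N :=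
      hcont.continuousAt.eventually_mem (by simpa using hNo.mem_nhds hzN)
    obtain ⟨ε, h1, h2⟩ := ((this.filter_mono nhdsWithin_le_nhds).and
      (eventually_mem_nhdsWithin (s := Ioi (0 : ℝ)))).exists
    exact ⟨ε, h2, h1⟩
  have hzi : ⟪z, x i⟫ = 0 := by rw [real_inner_comm]; exact hz
  have hxi : ⟪x i, x i⟫ = 1 := by rw [real_inner_self_eq_norm_sq, hx]; norm_num
  obtain ⟨w₁, ⟨hw₁, hw₁'⟩, h1⟩ := hne (N ∩ {w | 0 < ⟪w, x i⟫})
    (hNo.inter (isOpen_lt continuous_const (by fun_prop))) (by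
      obtain ⟨ε, hε, hεN⟩ := hdir 1 one_ne_zero
      refine ⟨_, hεN, ?_⟩
      simpa [inner_add_left, real_inner_smul_left, hzi, hxi, mem_ofPred_eq, hx] using hε)
  obtain ⟨w₂, ⟨hw₂, hw₂'⟩, h2⟩ := hne (N ∩ {w | ⟪w, x i⟫ < 0})
    (hNo.inter (isOpen_lt (by fun_prop) continuous_const)) (by
      obtain ⟨ε, hε, hεN⟩ := hdir (-1) (by norm_num)
      refine ⟨_, hεN, ?_⟩
      simpa [inner_add_left, real_inner_smul_left, hzi, hxi, mem_ofPred_eq, hx] using hε)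
  have hgate : ∀ w ∈ N, ∀ j, j ≠ i → gate w (x j) = gate z (x j) := by
    intro w hw j hj
    have h3 : 0 < ⟪w, x j⟫ * ⟪z, x j⟫ := mem_iInter₂.1 hw j hj
    have h4 : 0 ≤ ⟪w, x j⟫ ↔ 0 ≤ ⟪z, x j⟫ := by
      rcases mul_pos_iff.1 h3 with h | h
      · exact ⟨fun _ => h.2.le, fun _ => h.1.le⟩
      · exact ⟨fun h5 => absurd h.1 (not_lt.2 h5), fun h5 => absurd h.2 (not_lt.2 h5)⟩
    simp only [gate, h4]
  have hdiff : ∑ j, (c j * gate w₁ (x j)) • x j - ∑ j, (c j * gate w₂ (x j)) • x j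
      = c i • x i := by
    rw [← Finset.sum_sub_distrib, Finset.sum_eq_single i]
    · have e1 : gate w₁ (x i) = 1 := if_pos (le_of_lt hw₁')
      have e2 : gate w₂ (x i) = 0 := if_neg (not_le.2 hw₂')
      simp [e1, e2]
    · intro j _ hj
      rw [hgate w₁ hw₁ j hj, hgate w₂ hw₂ j hj, sub_self]
    · simp
  rw [h1, h2, sub_zero] at hdiff
  have hxi0 : x i ≠ 0 := norm_ne_zero_iff.1 (by rw [hx]; norm_num)
  exact (smul_eq_zero.1 hdiff.symm).resolve_right hxi0

/-- The infimum of a finite set is attained; `1 ≤ n` rules out the default `sInf ∅ = 0`. -/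
theorem lambdaZero_mem_spectrum (hn : 1 ≤ n) (x : Fin n → EuclideanSpace ℝ (Fin p)) :
    lambdaZero x ∈ spectrum ℝ (gramInfty x) := by
  have : Nonempty (Fin n) := ⟨⟨0, hn⟩⟩
  have hspec := (isHermitian_gramInfty x).spectrum_real_eq_range_eigenvalues
  have hne : (spectrum ℝ (gramInfty x)).Nonempty := by
    rw [hspec]; exact range_nonempty _
  have hfin : (spectrum ℝ (gramInfty x)).Finite := by
    rw [hspec]; exact finite_range _
  exact hne.csInf_mem hfin

theorem lambdaZero_pos (hn : 1 ≤ n) {x : Fin n → EuclideanSpace ℝ (Fin p)} (hx : ∀ i, ‖x i‖ = 1)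
    (hxx : ∀ i j, i ≠ j → LinearIndependent ℝ ![x i, x j]) : 0 < lambdaZero x := by
  have h := lambdaZero_mem_spectrum hn x
  rw [(isHermitian_gramInfty x).spectrum_real_eq_range_eigenvalues] at h
  obtain ⟨i, hi⟩ := h
  rw [← hi]
  exact (posDef_gramInfty hx hxx).eigenvalues_pos i

theorem lambdaZero_mul_le (x : Fin n → EuclideanSpace ℝ (Fin p)) (z : Fin n → ℝ) :
    lambdaZero x * ∑ i, z i ^ 2 ≤ ∑ i, ∑ j, z i * z j * gramInfty x i j := by
  set H := gramInfty x
  have hps : (H - algebraMap ℝ _ (lambdaZero x)).PosSemidef := by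
    rw [Matrix.posSemidef_iff_isHermitian_and_spectrum_nonneg]
    refine ⟨(isHermitian_gramInfty x).sub ?_, ?_⟩
    · rw [Matrix.algebraMap_eq_diagonal]
      exact Matrix.isHermitian_diagonal _
    · rw [← spectrum.sub_singleton_eq]
      rintro _ ⟨μ, hμ, _, rfl, rfl⟩
      have hfin : (spectrum ℝ (gramInfty x)).Finite := by
        rw [(isHermitian_gramInfty x).spectrum_real_eq_range_eigenvalues]; exact finite_range _
      exact sub_nonneg.2 (csInf_le hfin.bddBelow hμ)
  have := hps.dotProduct_mulVec_nonneg z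
  rw [star_trivial, Matrix.sub_mulVec, dotProduct_sub, dotProduct_gramInfty_mulVec,
    Algebra.algebraMap_eq_smul_one, Matrix.smul_mulVec, Matrix.one_mulVec, dotProduct_smul,
    smul_eq_mul] at this
  simp only [dotProduct, ← pow_two] at this
  linarith

/-- Tests the quadratic form on a basis vector. It is needed to compare powers of `λ₀` in the width
condition. -/
theorem lambdaZero_le_one (hn : 1 ≤ n) {x : Fin n → EuclideanSpace ℝ (Fin p)}
    (hx : ∀ i, ‖x i‖ = 1) : lambdaZero x ≤ 1 := by
  have h := lambdaZero_mul_le x (Pi.single ⟨0, hn⟩ 1)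
  simp only [Pi.single_apply, ite_pow, one_pow, ne_eq, OfNat.ofNat_ne_zero, not_false_eq_true,
    zero_pow, Finset.sum_ite_eq', Finset.mem_univ, if_true, mul_one, ite_mul, one_mul, zero_mul,
    mul_ite, mul_zero] at h
  rw [gramInfty_apply] at h
  refine h.trans ?_
  refine (integral_mono (integrable_gate_mul x _ _) (integrable_const 1) fun w => ?_).trans (by simp)
  rw [real_inner_self_eq_norm_sq, hx, one_pow, mul_one]
  exact mul_le_one₀ (gate_le_one _ _) (gate_nonneg _ _) (gate_le_one _ _)

end Gram

/-- Markov's inequality for a nonnegative real function. -/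
theorem measure_lt_le_of_lintegral_le {Ω : Type*} {mΩ : MeasurableSpace Ω} {μ : Measure Ω}
    {f : Ω → ℝ} (hf : Measurable f) {e c : ℝ} (hc : 0 < c)
    (h : ∫⁻ ω, ENNReal.ofReal (f ω) ∂μ ≤ ENNReal.ofReal e) :
    μ {ω | c < f ω} ≤ ENNReal.ofReal (e / c) := by
  have h1 := meas_ge_le_lintegral_div (μ := μ) hf.ennreal_ofReal.aemeasurable
    (ENNReal.ofReal_pos.2 hc).ne' ENNReal.ofReal_ne_top
  rw [ENNReal.ofReal_div_of_pos hc]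
  refine (measure_mono fun ω hω => ?_).trans (h1.trans (ENNReal.div_le_div_right h _))
  exact ENNReal.ofReal_le_ofReal (le_of_lt hω)

/-! ### One-dimensional Gaussian estimates. -/

section Gaussian

variable {p : ℕ} {x : EuclideanSpace ℝ (Fin p)}

theorem map_inner_stdGaussian (hx : ‖x‖ = 1) :
    (stdGaussian (EuclideanSpace ℝ (Fin p))).map (fun w => ⟪w, x⟫) = gaussianReal 0 1 := by
  have h := IsGaussian.map_eq_gaussianReal (μ := stdGaussian (EuclideanSpace ℝ (Fin p)))
    (innerSL ℝ x)
  rw [integral_strongDual_stdGaussian, variance_dual_stdGaussian, innerSL_apply_norm, hx] at h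
  simp only [one_pow, Real.toNNReal_one] at h
  rw [← h]
  congr 1
  ext w
  exact real_inner_comm _ _

/-- The standard normal density is at most `1/√(2π) ≤ 1/2`, on an interval of length `2R`. -/
theorem measure_abs_inner_le (hx : ‖x‖ = 1) (R : ℝ) :
    stdGaussian (EuclideanSpace ℝ (Fin p)) {w | |⟪w, x⟫| ≤ R} ≤ ENNReal.ofReal R := by
  have hset : {w : EuclideanSpace ℝ (Fin p) | |⟪w, x⟫| ≤ R} = (fun w => ⟪w, x⟫) ⁻¹' Icc (-R) R := by
    ext w; simp [abs_le]
  rw [hset, ← Measure.map_apply (by fun_prop) measurableSet_Icc, map_inner_stdGaussian hx,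
    gaussianReal_apply 0 one_ne_zero]
  have hpdf : ∀ z, gaussianPDF 0 1 z ≤ ENNReal.ofReal (1 / 2) := by
    intro z
    refine ENNReal.ofReal_le_ofReal ?_
    rw [gaussianPDFReal]
    have h1 : (2 : ℝ) ≤ √(2 * Real.pi * (1 : NNReal)) := by
      refine Real.le_sqrt_of_sq_le ?_
      push_cast
      nlinarith [Real.pi_gt_three]
    have h2 : (√(2 * Real.pi * (1 : NNReal)))⁻¹ ≤ 1 / 2 := by
      rw [one_div]; exact inv_anti₀ two_pos h1
    have h3 : Real.exp (-(z - 0) ^ 2 / (2 * (1 : NNReal))) ≤ 1 := by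
      rw [Real.exp_le_one_iff]
      push_cast
      nlinarith [sq_nonneg (z - 0)]
    calc _ ≤ 1 / 2 * 1 := mul_le_mul h2 h3 (Real.exp_nonneg _) (by norm_num)
      _ = _ := mul_one _
  calc _ ≤ ∫⁻ _ in Icc (-R) R, ENNReal.ofReal (1 / 2) := lintegral_mono hpdf
    _ = ENNReal.ofReal R := by
      rw [setLIntegral_const, Real.volume_Icc, ← ENNReal.ofReal_mul (by norm_num)]
      congr 1; ring

theorem lintegral_sq_relu_inner_le (hx : ‖x‖ = 1) :
    ∫⁻ w, ENNReal.ofReal (relu ⟪w, x⟫ ^ 2) ∂stdGaussian (EuclideanSpace ℝ (Fin p)) ≤ 1 := by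
  have h1 : ∫⁻ w, ENNReal.ofReal (⟪w, x⟫ ^ 2) ∂stdGaussian (EuclideanSpace ℝ (Fin p)) =
      ∫⁻ z, ENNReal.ofReal (z ^ 2) ∂gaussianReal 0 1 := by
    rw [← map_inner_stdGaussian hx, lintegral_map (by fun_prop) (by fun_prop)]
  have h2 : ∫⁻ z, ENNReal.ofReal (z ^ 2) ∂gaussianReal 0 1 = 1 := by
    have hm : MemLp (fun z : ℝ => z) 2 (gaussianReal 0 1) := IsGaussian.memLp_two_id
    rw [← ofReal_integral_eq_lintegral_ofReal hm.integrable_sq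
      (Eventually.of_forall fun z => sq_nonneg _)]
    have := variance_of_integral_eq_zero (X := id) (μ := gaussianReal 0 1) aemeasurable_id
      (by simp)
    rw [variance_id_gaussianReal] at this
    simp only [id] at this
    rw [← this]; simp
  rw [← h2, ← h1]
  refine lintegral_mono fun w => ENNReal.ofReal_le_ofReal ?_
  simp only [relu]
  rcases le_total ⟪w, x⟫ 0 with h | h
  · rw [max_eq_right h]; nlinarith [sq_nonneg ⟪w, x⟫]
  · rw [max_eq_left h]

end Gaussian

/-! ### Random signs. -/

section Signs

theorem uniformOn_neg_one_one :
    uniformOn ({-1, 1} : Set ℝ) =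
      (2 : ENNReal)⁻¹ • (Measure.dirac (-1) + Measure.dirac 1) := by
  have hd : Disjoint ({-1} : Set ℝ) {1} := by
    rw [disjoint_singleton]; norm_num
  have hc : Measure.count ({-1, 1} : Set ℝ) = 2 := by
    rw [show ({-1, 1} : Set ℝ) = {-1} ∪ {1} from rfl, measure_union hd (measurableSet_singleton _),
      Measure.count_singleton, Measure.count_singleton, one_add_one_eq_two]
  rw [uniformOn, ProbabilityTheory.cond, hc]
  congr 1
  rw [show ({-1, 1} : Set ℝ) = {-1} ∪ {1} from rfl, Measure.restrict_union hd (by simp),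
    Measure.restrict_singleton, Measure.restrict_singleton]
  simp

instance isProbabilityMeasure_signs : IsProbabilityMeasure (uniformOn ({-1, 1} : Set ℝ)) :=
  isProbabilityMeasure_uniformOn (Set.toFinite _) (Set.insert_nonempty _ _)

theorem ae_signs_sq : ∀ᵐ b ∂uniformOn ({-1, 1} : Set ℝ), b ^ 2 = 1 := by
  rw [uniformOn_neg_one_one]
  refine Measure.ae_smul_measure ?_ _
  rw [ae_add_measure_iff]
  constructor <;> simp [ae_dirac_eq]

theorem memLp_signs : MemLp id 2 (uniformOn ({-1, 1} : Set ℝ)) := by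
  refine MemLp.of_bound aestronglyMeasurable_id 1 (ae_signs_sq.mono fun b hb => ?_)
  simp only [id, Real.norm_eq_abs]
  rw [← sq_abs] at hb
  nlinarith [abs_nonneg b]

theorem integral_signs : ∫ b, b ∂uniformOn ({-1, 1} : Set ℝ) = 0 := by
  rw [uniformOn_neg_one_one, integral_smul_measure, integral_add_measure] <;>
    simp [integrable_dirac]

theorem variance_signs : Var[id; uniformOn ({-1, 1} : Set ℝ)] = 1 := by
  rw [variance_of_integral_eq_zero aemeasurable_id (by simpa using integral_signs),
    integral_congr_ae (ae_signs_sq.mono fun b hb => (by simpa using hb : (id b) ^ 2 = (1 : ℝ)))]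
  simp

theorem lintegral_sq_sum_signs {m : ℕ} (c : Fin m → ℝ) :
    ∫⁻ a, ENNReal.ofReal ((∑ r, c r * a r) ^ 2)
      ∂(Measure.pi fun _ : Fin m => uniformOn ({-1, 1} : Set ℝ)) =
        ENNReal.ofReal (∑ r, c r ^ 2) := by
  set μ := Measure.pi fun _ : Fin m => uniformOn ({-1, 1} : Set ℝ)
  have hm : ∀ r, MemLp (fun b : ℝ => c r * b) 2 (uniformOn ({-1, 1} : Set ℝ)) := fun r =>
    memLp_signs.const_mul (c r)
  have hm' : ∀ r, MemLp (fun a : Fin m → ℝ => c r * a r) 2 μ := fun r =>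
    (hm r).comp_measurePreserving (measurePreserving_eval _ r)
  have hvar := variance_sum_pi hm
  have h0 : ∫ a, (∑ r, c r * a r) ∂μ = 0 := by
    rw [integral_finsetSum _ fun r _ => (hm' r).integrable one_le_two]
    refine Finset.sum_eq_zero fun r _ => ?_
    have := integral_comp_eval (μ := fun _ : Fin m => uniformOn ({-1, 1} : Set ℝ)) (i := r)
      (f := fun b : ℝ => b) aestronglyMeasurable_id
    rw [integral_const_mul, this, integral_signs, mul_zero]
  have he : (∑ r, fun a : Fin m → ℝ => c r * a r) = fun a => ∑ r, c r * a r := by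
    ext a; simp
  rw [he, variance_of_integral_eq_zero
    (Measurable.aemeasurable (by fun_prop)) h0] at hvar
  rw [← ofReal_integral_eq_lintegral_ofReal (memLp_finsetSum _ fun r _ => hm' r).integrable_sq
    (Eventually.of_forall fun z => sq_nonneg _), hvar]
  congr 1
  refine Finset.sum_congr rfl fun r _ => ?_
  have := variance_const_mul (c r) id (uniformOn ({-1, 1} : Set ℝ))
  rw [variance_signs, mul_one] at this
  exact this

end Signs

/-! ### Expectations at initialization and the good event. -/

section Events

variable {n m p : ℕ} {x : Fin n → EuclideanSpace ℝ (Fin p)} {y : Fin n → ℝ}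

instance isProbabilityMeasure_initLaw : IsProbabilityMeasure (initLaw m p) := by
  unfold initLaw; infer_instance

theorem measurable_relu : Measurable relu := measurable_id.max measurable_const

theorem measurable_loss (x : Fin n → EuclideanSpace ℝ (Fin p)) (y : Fin n → ℝ) :
    Measurable fun z : (Fin m → EuclideanSpace ℝ (Fin p)) × (Fin m → ℝ) => loss x y z.1 z.2 := by
  have := measurable_relu
  unfold loss network
  fun_prop

theorem lintegral_eval_pi {Ω : Type*} [MeasurableSpace Ω] {μ : Measure Ω} [IsProbabilityMeasure μ]
    {f : Ω → ENNReal} (hf : Measurable f) (r : Fin m) :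
    ∫⁻ ω, f (ω r) ∂(Measure.pi fun _ : Fin m => μ) = ∫⁻ w, f w ∂μ :=
  (measurePreserving_eval (fun _ : Fin m => μ) r).lintegral_comp hf

/-- For fixed weights the independent centred signs kill the cross terms, leaving the average of
`σ(wᵣᵀ v)²`, of mean at most 1. -/
theorem lintegral_sq_network_le (hm : 0 < m) {v : EuclideanSpace ℝ (Fin p)} (hv : ‖v‖ = 1) :
    ∫⁻ z, ENNReal.ofReal (network z.1 z.2 v ^ 2) ∂initLaw m p ≤ 1 := by
  have hr := measurable_relu
  have hmeas : Measurable fun z : (Fin m → EuclideanSpace ℝ (Fin p)) × (Fin m → ℝ) =>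
      ENNReal.ofReal (network z.1 z.2 v ^ 2) := by
    unfold network; fun_prop
  rw [initLaw, lintegral_prod _ hmeas.aemeasurable]
  have h1 : ∀ W : Fin m → EuclideanSpace ℝ (Fin p),
      ∫⁻ a, ENNReal.ofReal (network W a v ^ 2)
        ∂(Measure.pi fun _ : Fin m => uniformOn ({-1, 1} : Set ℝ)) =
      ∑ r, ENNReal.ofReal (1 / m) * ENNReal.ofReal (relu ⟪W r, v⟫ ^ 2) := by
    intro W
    have e1 : ∀ a : Fin m → ℝ, network W a v = ∑ r, (1 / √(m : ℝ) * relu ⟪W r, v⟫) * a r := by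
      intro a
      rw [network, Finset.mul_sum]
      exact Finset.sum_congr rfl fun r _ => by ring
    simp only [e1]
    rw [lintegral_sq_sum_signs, ENNReal.ofReal_sum_of_nonneg fun r _ => sq_nonneg _]
    refine Finset.sum_congr rfl fun r _ => ?_
    rw [← ENNReal.ofReal_mul (by positivity), mul_pow, div_pow, one_pow,
      Real.sq_sqrt (Nat.cast_nonneg m)]
  simp only [h1]
  rw [lintegral_finsetSum _ fun r _ => by fun_prop]
  have h2 : ∀ r : Fin m, ∫⁻ W, ENNReal.ofReal (1 / m) * ENNReal.ofReal (relu ⟪W r, v⟫ ^ 2)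
      ∂(Measure.pi fun _ : Fin m => stdGaussian (EuclideanSpace ℝ (Fin p))) ≤
      ENNReal.ofReal (1 / m) := by
    intro r
    rw [lintegral_const_mul _ (by fun_prop),
      lintegral_eval_pi (f := fun w => ENNReal.ofReal (relu ⟪w, v⟫ ^ 2)) (by fun_prop) r]
    exact mul_le_of_le_one_right' (lintegral_sq_relu_inner_le hv)
  refine (Finset.sum_le_sum fun r _ => h2 r).trans ?_
  rw [Finset.sum_const, Finset.card_univ, Fintype.card_fin, ← ENNReal.ofReal_nsmul]
  have : (0 : ℝ) < m := Nat.cast_pos.2 hm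
  rw [nsmul_eq_mul, mul_one_div_cancel this.ne', ENNReal.ofReal_one]

theorem lintegral_loss_le (hm : 0 < m) (hx : ∀ i, ‖x i‖ = 1) {B : ℝ} (hy : ∀ i, |y i| < B) :
    ∫⁻ z, ENNReal.ofReal (loss x y z.1 z.2) ∂initLaw m p ≤
      ENNReal.ofReal (n * (1 + B ^ 2)) := by
  have hr := measurable_relu
  have hbound : ∀ z : (Fin m → EuclideanSpace ℝ (Fin p)) × (Fin m → ℝ),
      ENNReal.ofReal (loss x y z.1 z.2) ≤
        ∑ i, (ENNReal.ofReal (network z.1 z.2 (x i) ^ 2) + ENNReal.ofReal (B ^ 2)) := by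
    intro z
    simp only [← ENNReal.ofReal_add (sq_nonneg _) (sq_nonneg _)]
    rw [← ENNReal.ofReal_sum_of_nonneg fun i _ => add_nonneg (sq_nonneg _) (sq_nonneg _)]
    refine ENNReal.ofReal_le_ofReal ?_
    rw [loss, Finset.mul_sum]
    refine Finset.sum_le_sum fun i _ => ?_
    have h1 : y i ^ 2 ≤ B ^ 2 := by
      rw [← sq_abs]; exact pow_le_pow_left₀ (abs_nonneg _) (hy i).le 2
    nlinarith [sq_nonneg (network z.1 z.2 (x i) + y i)]
  refine (lintegral_mono hbound).trans ?_
  have hmeas : ∀ i, Measurable fun z : (Fin m → EuclideanSpace ℝ (Fin p)) × (Fin m → ℝ) =>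
      ENNReal.ofReal (network z.1 z.2 (x i) ^ 2) := by
    intro i; unfold network; fun_prop
  rw [lintegral_finsetSum _ fun i _ => (hmeas i).add_const _]
  have h2 : ∀ i, ∫⁻ z, (ENNReal.ofReal (network z.1 z.2 (x i) ^ 2) + ENNReal.ofReal (B ^ 2))
      ∂initLaw m p ≤ ENNReal.ofReal (1 + B ^ 2) := by
    intro i
    rw [lintegral_add_left (hmeas i), lintegral_const, measure_univ, mul_one,
      ENNReal.ofReal_add zero_le_one (sq_nonneg _), ENNReal.ofReal_one]
    gcongr
    exact lintegral_sq_network_le hm (hx i)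
  refine (Finset.sum_le_sum fun i _ => h2 i).trans ?_
  rw [Finset.sum_const, Finset.card_univ, Fintype.card_fin, ← ENNReal.ofReal_nsmul, nsmul_eq_mul]

theorem measurable_nearKink (x : Fin n → EuclideanSpace ℝ (Fin p)) (R : ℝ) :
    Measurable fun W : Fin m → EuclideanSpace ℝ (Fin p) => nearKink x W R := by
  unfold nearKink
  refine Finset.measurable_sum _ fun i _ => Finset.measurable_sum _ fun r _ => ?_
  exact Measurable.ite (measurableSet_le (by fun_prop) measurable_const) measurable_const
    measurable_const

theorem lintegral_nearKink_le (hx : ∀ i, ‖x i‖ = 1) (R : ℝ) :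
    ∫⁻ W, ENNReal.ofReal (nearKink x W R)
      ∂(Measure.pi fun _ : Fin m => stdGaussian (EuclideanSpace ℝ (Fin p))) ≤
      ENNReal.ofReal (n * (m * R)) := by
  classical
  have e1 : ∀ W : Fin m → EuclideanSpace ℝ (Fin p), ENNReal.ofReal (nearKink x W R) =
      ∑ i, ∑ r, {w | |⟪w, x i⟫| ≤ R}.indicator 1 (W r) := by
    intro W
    have h0 : ∀ i r, (0 : ℝ) ≤ if |⟪W r, x i⟫| ≤ R then 1 else 0 := by
      intro i r; split_ifs <;> norm_num
    rw [nearKink, ENNReal.ofReal_sum_of_nonneg fun i _ => Finset.sum_nonneg fun r _ => by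
      convert h0 i r]
    refine Finset.sum_congr rfl fun i _ => ?_
    rw [ENNReal.ofReal_sum_of_nonneg fun r _ => by convert h0 i r]
    refine Finset.sum_congr rfl fun r _ => ?_
    by_cases h : |⟪W r, x i⟫| ≤ R <;> simp [indicator, h]
  have hs : ∀ i, MeasurableSet {w : EuclideanSpace ℝ (Fin p) | |⟪w, x i⟫| ≤ R} := fun i =>
    measurableSet_le (by fun_prop) measurable_const
  have hmeas : ∀ i, Measurable
      ({w : EuclideanSpace ℝ (Fin p) | |⟪w, x i⟫| ≤ R}.indicator (1 : EuclideanSpace ℝ (Fin p) → ENNReal)) := fun i =>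
    measurable_one.indicator (hs i)
  have hmeas' : ∀ i (r : Fin m), Measurable fun W : Fin m → EuclideanSpace ℝ (Fin p) =>
      {w | |⟪w, x i⟫| ≤ R}.indicator (1 : EuclideanSpace ℝ (Fin p) → ENNReal) (W r) := fun i r =>
    (hmeas i).comp (measurable_pi_apply r)
  simp only [e1]
  rw [lintegral_finsetSum _ fun i _ => Finset.measurable_sum _ fun r _ => hmeas' i r]
  have h2 : ∀ i, ∫⁻ W, ∑ r, {w | |⟪w, x i⟫| ≤ R}.indicator 1 (W r)
      ∂(Measure.pi fun _ : Fin m => stdGaussian (EuclideanSpace ℝ (Fin p))) ≤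
      ENNReal.ofReal (m * R) := by
    intro i
    rw [lintegral_finsetSum _ fun r _ => hmeas' i r]
    have h3 : ∀ r : Fin m, ∫⁻ W, {w | |⟪w, x i⟫| ≤ R}.indicator 1 (W r)
        ∂(Measure.pi fun _ : Fin m => stdGaussian (EuclideanSpace ℝ (Fin p))) ≤
        ENNReal.ofReal R := by
      intro r
      rw [lintegral_eval_pi (hmeas i) r, lintegral_indicator_one (hs i)]
      exact measure_abs_inner_le (hx i) R
    refine (Finset.sum_le_sum fun r _ => h3 r).trans ?_
    rw [Finset.sum_const, Finset.card_univ, Fintype.card_fin, ← ENNReal.ofReal_nsmul, nsmul_eq_mul]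
  refine (Finset.sum_le_sum fun i _ => h2 i).trans ?_
  rw [Finset.sum_const, Finset.card_univ, Fintype.card_fin, ← ENNReal.ofReal_nsmul, nsmul_eq_mul]

/-- The squared Frobenius distance between the empirical Gram matrix and its limit. -/
noncomputable def gramError (x : Fin n → EuclideanSpace ℝ (Fin p))
    (W : Fin m → EuclideanSpace ℝ (Fin p)) : ℝ :=
  ∑ i, ∑ j, ((∑ r, gate (W r) (x i) * gate (W r) (x j) * ⟪x i, x j⟫) / m - gramInfty x i j) ^ 2

theorem measurable_gramError (x : Fin n → EuclideanSpace ℝ (Fin p)) :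
    Measurable fun W : Fin m → EuclideanSpace ℝ (Fin p) => gramError x W := by
  have : ∀ i, Measurable fun w => gate w (x i) := fun i => measurable_gate (x i)
  unfold gramError
  fun_prop

/-- The variance of an average of `m` independent copies; values in `[-1, 1]` have variance at most
1. -/
theorem lintegral_sq_average_sub_le {Ω : Type*} [MeasurableSpace Ω] {μ : Measure Ω}
    [IsProbabilityMeasure μ] (hm : 0 < m) {f : Ω → ℝ} (hf : Measurable f) (hb : ∀ ω, |f ω| ≤ 1) :
    ∫⁻ ω, ENNReal.ofReal (((∑ r, f (ω r)) / m - ∫ w, f w ∂μ) ^ 2)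
      ∂(Measure.pi fun _ : Fin m => μ) ≤ ENNReal.ofReal (1 / m) := by
  have hm0 : (0 : ℝ) < m := Nat.cast_pos.2 hm
  have hLp : MemLp f 2 μ := MemLp.of_bound hf.aestronglyMeasurable 1 (Eventually.of_forall hb)
  set ν := Measure.pi fun _ : Fin m => μ
  have hLp' : ∀ r : Fin m, MemLp (fun ω : Fin m → Ω => f (ω r)) 2 ν := fun r =>
    hLp.comp_measurePreserving (measurePreserving_eval _ r)
  have hsum : MemLp (fun ω : Fin m → Ω => ∑ r, f (ω r)) 2 ν := memLp_finsetSum _ fun r _ => hLp' r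
  have hmean : ∫ ω, ∑ r, f (ω r) ∂ν = m * ∫ w, f w ∂μ := by
    rw [integral_finsetSum _ fun r _ => (hLp' r).integrable one_le_two]
    have : ∀ r : Fin m, ∫ ω, f (ω r) ∂ν = ∫ w, f w ∂μ := fun r =>
      integral_comp_eval (μ := fun _ : Fin m => μ) hf.aestronglyMeasurable
    simp [this]
  have hvar : Var[fun ω => ∑ r, f (ω r); ν] ≤ m := by
    have h1 := variance_sum_pi (μ := fun _ : Fin m => μ) fun _ : Fin m => hLp
    have he : (∑ r, fun ω : Fin m → Ω => f (ω r)) = fun ω => ∑ r, f (ω r) := by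
      ext a; simp
    rw [he] at h1
    rw [h1]
    have h2 : Var[f; μ] ≤ 1 := by
      have := variance_le_sq_of_bounded (μ := μ) (a := -1) (b := 1)
        (Eventually.of_forall fun ω => abs_le.1 (hb ω)) hf.aemeasurable
      norm_num at this
      exact this
    refine (Finset.sum_le_sum fun r _ => h2).trans ?_
    simp
  rw [variance_eq_integral hsum.aestronglyMeasurable.aemeasurable, hmean] at hvar
  have e1 : ∀ ω : Fin m → Ω, ((∑ r, f (ω r)) / m - ∫ w, f w ∂μ) ^ 2 =
      (1 / m ^ 2) * (∑ r, f (ω r) - m * ∫ w, f w ∂μ) ^ 2 := by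
    intro ω; field_simp
  simp only [e1]
  have hsq : Integrable (fun ω => (∑ r, f (ω r) - m * ∫ w, f w ∂μ) ^ 2) ν :=
    (hsum.sub (memLp_const (m * ∫ w, f w ∂μ))).integrable_sq
  rw [← ofReal_integral_eq_lintegral_ofReal (hsq.const_mul _)
    (Eventually.of_forall fun z => by positivity), integral_const_mul]
  refine ENNReal.ofReal_le_ofReal ((mul_le_mul_of_nonneg_left hvar (by positivity)).trans_eq ?_)
  field_simp

theorem lintegral_gramError_le (hm : 0 < m) (hx : ∀ i, ‖x i‖ = 1) :
    ∫⁻ W, ENNReal.ofReal (gramError x W)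
      ∂(Measure.pi fun _ : Fin m => stdGaussian (EuclideanSpace ℝ (Fin p))) ≤
      ENNReal.ofReal (n * (n * (1 / m))) := by
  have hg : ∀ i, Measurable fun w => gate w (x i) := fun i => measurable_gate (x i)
  have e1 : ∀ W : Fin m → EuclideanSpace ℝ (Fin p), ENNReal.ofReal (gramError x W) =
      ∑ i, ∑ j, ENNReal.ofReal
        (((∑ r, gate (W r) (x i) * gate (W r) (x j) * ⟪x i, x j⟫) / m - gramInfty x i j) ^ 2) := by
    intro W
    rw [gramError, ENNReal.ofReal_sum_of_nonneg fun i _ => Finset.sum_nonneg fun r _ => sq_nonneg _]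
    refine Finset.sum_congr rfl fun i _ => ?_
    rw [ENNReal.ofReal_sum_of_nonneg fun r _ => sq_nonneg _]
  have h1 : ∀ i j, ∫⁻ W, ENNReal.ofReal
        (((∑ r, gate (W r) (x i) * gate (W r) (x j) * ⟪x i, x j⟫) / m - gramInfty x i j) ^ 2)
      ∂(Measure.pi fun _ : Fin m => stdGaussian (EuclideanSpace ℝ (Fin p))) ≤
      ENNReal.ofReal (1 / m) := by
    intro i j
    rw [gramInfty_apply]
    refine lintegral_sq_average_sub_le hm (f := fun w => gate w (x i) * gate w (x j) * ⟪x i, x j⟫)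
      (by fun_prop) fun w => ?_
    rw [abs_mul, abs_of_nonneg (mul_nonneg (gate_nonneg _ _) (gate_nonneg _ _))]
    have h2 := abs_real_inner_le_norm (x i) (x j)
    rw [hx, hx, mul_one] at h2
    exact mul_le_one₀ (mul_le_one₀ (gate_le_one _ _) (gate_nonneg _ _) (gate_le_one _ _))
      (abs_nonneg _) h2
  simp only [e1]
  rw [lintegral_finsetSum _ fun i _ => by fun_prop]
  have h2 : ∀ i, ∫⁻ W, ∑ j, ENNReal.ofReal
        (((∑ r, gate (W r) (x i) * gate (W r) (x j) * ⟪x i, x j⟫) / m - gramInfty x i j) ^ 2)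
      ∂(Measure.pi fun _ : Fin m => stdGaussian (EuclideanSpace ℝ (Fin p))) ≤
      ENNReal.ofReal (n * (1 / m)) := by
    intro i
    rw [lintegral_finsetSum _ fun j _ => by fun_prop]
    refine (Finset.sum_le_sum fun j _ => h1 i j).trans ?_
    rw [Finset.sum_const, Finset.card_univ, Fintype.card_fin, ← ENNReal.ofReal_nsmul, nsmul_eq_mul]
  refine (Finset.sum_le_sum fun i _ => h2 i).trans ?_
  rw [Finset.sum_const, Finset.card_univ, Fintype.card_fin, ← ENNReal.ofReal_nsmul, nsmul_eq_mul]

/-- If the empirical Gram matrix is close to its limit, the adjoint of the initial Jacobian is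
bounded below. -/
theorem le_sq_norm_jacobian_adjoint {a : Fin m → ℝ} (ha : ∀ r, a r ^ 2 = 1)
    (hpos : 0 ≤ lambdaZero x) {W : Fin m → EuclideanSpace ℝ (Fin p)}
    (h : gramError x W ≤ (lambdaZero x / 2) ^ 2) (z : EuclideanSpace ℝ (Fin n)) :
    lambdaZero x / 2 * ‖z‖ ^ 2 ≤ ‖(jacobian x a (pattern x W)).adjoint z‖ ^ 2 := by
  have hz : ‖z‖ ^ 2 = ∑ i, z i ^ 2 := by
    rw [EuclideanSpace.norm_sq_eq]; simp
  set D : Fin n → Fin n → ℝ := fun i j =>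
    (∑ r, gate (W r) (x i) * gate (W r) (x j) * ⟪x i, x j⟫) / m - gramInfty x i j with hD
  -- The signs enter squared, so this is the quadratic form of the empirical Gram matrix: its limit
  -- plus `D`. The `D` part is bounded by Cauchy–Schwarz over pairs, i.e. by the Frobenius norm.
  have e1 : ‖(jacobian x a (pattern x W)).adjoint z‖ ^ 2 =
      ∑ i, ∑ j, z i * z j * gramInfty x i j + ∑ i, ∑ j, z i * z j * D i j := by
    rw [jacobian_adjoint_apply, PiLp.norm_sq_eq_of_L2]
    simp only [stack, sq_norm_sum_smul]
    rw [Finset.sum_comm, ← Finset.sum_add_distrib]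
    refine Finset.sum_congr rfl fun i _ => ?_
    rw [Finset.sum_comm, ← Finset.sum_add_distrib]
    refine Finset.sum_congr rfl fun j _ => ?_
    rw [hD, ← mul_add, add_sub_cancel, Finset.sum_div, Finset.mul_sum]
    refine Finset.sum_congr rfl fun r _ => ?_
    have e2 : (1 / √(m : ℝ)) * (1 / √m) = 1 / m := by
      rw [one_div_mul_one_div, Real.mul_self_sqrt (Nat.cast_nonneg m)]
    calc _ = z i * z j * (gate (W r) (x i) * gate (W r) (x j) * ⟪x i, x j⟫) * a r ^ 2 *
          ((1 / √(m : ℝ)) * (1 / √m)) := by simp only [pattern]; ring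
      _ = _ := by rw [ha, e2]; ring
  have h1 := lambdaZero_mul_le x z
  have h2 : |∑ i, ∑ j, z i * z j * D i j| ≤ lambdaZero x / 2 * ‖z‖ ^ 2 := by
    refine abs_le_of_sq_le_sq ?_ (by positivity)
    have h3 := Finset.sum_mul_sq_le_sq_mul_sq (Finset.univ : Finset (Fin n × Fin n))
      (fun q => z q.1 * z q.2) fun q => D q.1 q.2
    rw [← Finset.univ_product_univ, Finset.sum_product, Finset.sum_product, Finset.sum_product] at h3
    have h4 : ∑ i, ∑ j, (z i * z j) ^ 2 = (‖z‖ ^ 2) ^ 2 := by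
      rw [hz, pow_two, Finset.sum_mul_sum]
      exact Finset.sum_congr rfl fun i _ => Finset.sum_congr rfl fun j _ => by ring
    simp only [h4] at h3
    refine h3.trans ?_
    rw [mul_pow, mul_comm]
    exact mul_le_mul_of_nonneg_right h (sq_nonneg _)
  rw [← hz] at h1
  rw [e1]
  linarith [(abs_le.1 h2).1]

end Events

theorem ae_initLaw_sq (m p : ℕ) : ∀ᵐ z ∂initLaw m p, ∀ r, z.2 r ^ 2 = 1 := by
  rw [ae_all_iff]
  intro r
  have h1 : ∀ᵐ a ∂(Measure.pi fun _ : Fin m => uniformOn ({-1, 1} : Set ℝ)), a r ^ 2 = 1 :=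
    (measurePreserving_eval (fun _ : Fin m => uniformOn ({-1, 1} : Set ℝ))
      r).quasiMeasurePreserving.ae ae_signs_sq
  exact (measurePreserving_snd (μ := Measure.pi fun _ : Fin m =>
    stdGaussian (EuclideanSpace ℝ (Fin p)))).quasiMeasurePreserving.ae h1

theorem lintegral_fst_initLaw {m p : ℕ} {f : (Fin m → EuclideanSpace ℝ (Fin p)) → ENNReal}
    (hf : Measurable f) :
    ∫⁻ z, f z.1 ∂initLaw m p =
      ∫⁻ W, f W ∂(Measure.pi fun _ : Fin m => stdGaussian (EuclideanSpace ℝ (Fin p))) :=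
  (measurePreserving_fst (ν := Measure.pi fun _ : Fin m =>
    uniformOn ({-1, 1} : Set ℝ))).lintegral_comp hf

/-- The initializations with bounded loss, Gram matrix close to its limit and few neurons near
their kinks have large probability. -/
theorem exists_good_initialization {n m p : ℕ} {x : Fin n → EuclideanSpace ℝ (Fin p)}
    {y : Fin n → ℝ} {B δ R : ℝ} (hn : 1 ≤ n) (hm : 0 < m) (hx : ∀ i, ‖x i‖ = 1)
    (hy : ∀ i, |y i| < B) (hδ : 0 < δ) (hR : 0 < R) (hl : 0 < lambdaZero x)
    (hmn : 12 * n ^ 2 / (δ * lambdaZero x ^ 2) ≤ m) :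
    ∃ G : Set ((Fin m → EuclideanSpace ℝ (Fin p)) × (Fin m → ℝ)),
      MeasurableSet G ∧ ENNReal.ofReal (1 - δ) ≤ initLaw m p G ∧ ∀ W a, (W, a) ∈ G →
        (∀ r, a r ^ 2 = 1) ∧ loss x y W a ≤ 3 * n * (1 + B ^ 2) / δ ∧
        gramError x W ≤ (lambdaZero x / 2) ^ 2 ∧ nearKink x W R / m ≤ 3 * n * R / δ := by
  have hn0 : (0 : ℝ) < n := Nat.cast_pos.2 hn
  have hm0 : (0 : ℝ) < m := Nat.cast_pos.2 hm
  set μ := initLaw m p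
  set f₁ : (Fin m → EuclideanSpace ℝ (Fin p)) × (Fin m → ℝ) → ℝ := fun z => loss x y z.1 z.2
  set f₂ : (Fin m → EuclideanSpace ℝ (Fin p)) × (Fin m → ℝ) → ℝ := fun z => gramError x z.1
  set f₃ : (Fin m → EuclideanSpace ℝ (Fin p)) × (Fin m → ℝ) → ℝ := fun z => nearKink x z.1 R
  have hf₁ : Measurable f₁ := measurable_loss x y
  have hf₂ : Measurable f₂ := (measurable_gramError x).comp measurable_fst
  have hf₃ : Measurable f₃ := (measurable_nearKink x R).comp measurable_fst
  have h1 : μ {z | 3 * n * (1 + B ^ 2) / δ < f₁ z} ≤ ENNReal.ofReal (δ / 3) := by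
    refine (measure_lt_le_of_lintegral_le hf₁ (by positivity) (lintegral_loss_le hm hx hy)).trans_eq
      ?_
    congr 1
    field_simp
  -- The width bound `hmn` says precisely that `(n²/m) / (λ₀/2)² ≤ δ/3`.
  have h2 : μ {z | (lambdaZero x / 2) ^ 2 < f₂ z} ≤ ENNReal.ofReal (δ / 3) := by
    refine (measure_lt_le_of_lintegral_le hf₂ (by positivity) ?_).trans
      (ENNReal.ofReal_le_ofReal ?_) (b := ENNReal.ofReal (n * (n * (1 / m)) / (lambdaZero x / 2) ^ 2))
    · exact (lintegral_fst_initLaw (measurable_gramError x).ennreal_ofReal).trans_le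
        (lintegral_gramError_le hm hx)
    · rw [div_le_iff₀ (by positivity)] at hmn ⊢
      rw [mul_one_div, mul_div_assoc', div_le_iff₀ hm0]
      nlinarith
  have h3 : μ {z | 3 * n * m * R / δ < f₃ z} ≤ ENNReal.ofReal (δ / 3) := by
    refine (measure_lt_le_of_lintegral_le hf₃ (by positivity) ?_).trans_eq ?_
      (b := ENNReal.ofReal (n * (m * R) / (3 * n * m * R / δ)))
    · exact (lintegral_fst_initLaw (measurable_nearKink x R).ennreal_ofReal).trans_le
        (lintegral_nearKink_le hx R)
    · congr 1
      field_simp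
  have h4 : μ {z | ¬ ∀ r, z.2 r ^ 2 = 1} = 0 := ae_initLaw_sq m p
  set G := {z | f₁ z ≤ 3 * n * (1 + B ^ 2) / δ} ∩ {z | f₂ z ≤ (lambdaZero x / 2) ^ 2} ∩
    {z | f₃ z ≤ 3 * n * m * R / δ} ∩ {z | ∀ r, z.2 r ^ 2 = 1} with hG
  have hGm : MeasurableSet G := by
    refine (((measurableSet_le hf₁ measurable_const).inter
      (measurableSet_le hf₂ measurable_const)).inter
      (measurableSet_le hf₃ measurable_const)).inter ?_
    rw [ofPred_forall]
    exact MeasurableSet.iInter fun r => measurableSet_eq_fun (by fun_prop) measurable_const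
  refine ⟨G, hGm, ?_, fun W a hz => ⟨hz.2, hz.1.1.1, hz.1.1.2, ?_⟩⟩
  · have hcompl : μ Gᶜ ≤ ENNReal.ofReal δ := by
      have hsub : Gᶜ ⊆ (({z | 3 * n * (1 + B ^ 2) / δ < f₁ z} ∪
          {z | (lambdaZero x / 2) ^ 2 < f₂ z}) ∪ {z | 3 * n * m * R / δ < f₃ z}) ∪
          {z | ¬ ∀ r, z.2 r ^ 2 = 1} := by
        intro z hz
        by_contra hcon
        simp only [mem_union, mem_ofPred_eq, not_or, not_lt, not_not] at hcon
        exact hz ⟨⟨⟨hcon.1.1.1, hcon.1.1.2⟩, hcon.1.2⟩, hcon.2⟩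
      calc μ Gᶜ ≤ _ := measure_mono hsub
        _ ≤ ((ENNReal.ofReal (δ / 3) + ENNReal.ofReal (δ / 3)) + ENNReal.ofReal (δ / 3)) + 0 :=
          (measure_union_le _ _).trans (add_le_add ((measure_union_le _ _).trans
            (add_le_add ((measure_union_le _ _).trans (add_le_add h1 h2)) h3)) h4.le)
        _ = ENNReal.ofReal δ := by
          rw [add_zero, ← ENNReal.ofReal_add (by positivity) (by positivity),
            ← ENNReal.ofReal_add (by positivity) (by positivity)]
          congr 1; ring
    have h5 := prob_compl_eq_one_sub (μ := μ) hGm.compl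
    rw [compl_compl] at h5
    rw [h5, ENNReal.ofReal_sub _ hδ.le, ENNReal.ofReal_one]
    exact tsub_le_tsub_left hcompl 1
  · rw [div_le_iff₀ hm0]
    refine hz.1.2.trans_eq ?_
    ring

end

/-! ### Choice of constants. -/

theorem mainTheorem2 (α γ : ℝ) (hγ : 6 < γ) (hα : 4 < α) (hαγ : α ≤ 2 * γ / 3) :
    ∃ C : ℝ, 0 < C ∧ ∀ B : ℝ, ∃ K : ℝ, 0 < K ∧
      ∀ (n p m : ℕ) (x : Fin n → EuclideanSpace ℝ (Fin p)) (y : Fin n → ℝ) (δ : ℝ),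
        1 ≤ n → (∀ i, ‖x i‖ = 1) → (∀ i j, i ≠ j → LinearIndependent ℝ ![x i, x j]) →
        (∀ i, |y i| < B) → 0 < δ → δ < 1 →
        K * ((n : ℝ) ^ (5 * α / 2 - 4) /
          (δ ^ (3 * α / 2 - 3) * lambdaZero x ^ (3 * α / 2 - 2))) ≤ (m : ℝ) →
        ∃ G : Set ((Fin m → EuclideanSpace ℝ (Fin p)) × (Fin m → ℝ)),
          MeasurableSet G ∧ ENNReal.ofReal (1 - δ) ≤ initLaw m p G ∧
          ∀ W₀ a, (W₀, a) ∈ G →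
            ∀ W V : ℝ → Fin m → EuclideanSpace ℝ (Fin p), IsNesterovFlow γ x y a W₀ W V →
              ∀ t : ℝ, 0 < t →
                loss x y (W t) a ≤
                  C / (lambdaZero x / 2) ^ (α / 2) * t ^ (-α) * loss x y (W 0) a := by
  refine ⟨2 * (3 * (1 + γ + α)) ^ α, by positivity, fun B => ?_⟩
  set A := 1 + √(2 * (3 * (1 + γ + α)) ^ α) / (α / 2 - 2) with hA
  have hA0 : 0 < A := by
    have : 0 < α / 2 - 2 := by linarith
    positivity
  -- The first summand keeps the displacement below `R`; the 12 serves the concentration of the Gram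
  -- matrix.
  refine ⟨6 * (1 + B ^ 2) * (432 * A) ^ 2 + 12, by positivity, ?_⟩
  intro n p m x y δ hn hx hxx hy hδ hδ1 hK
  have hl := lambdaZero_pos hn hx hxx
  have hl1 := lambdaZero_le_one hn hx
  set l := lambdaZero x with hldef
  have hn1 : (1 : ℝ) ≤ n := by exact_mod_cast hn
  have hn0 : (0 : ℝ) < n := by linarith
  -- Width of order `n⁴ / (δ³ λ₀⁴)` is enough; the stated power dominates it since `n ≥ 1`, `δ, λ₀ ≤
  -- 1` and `α > 4`.
  have hpow : (n : ℝ) ^ 4 / (δ ^ 3 * l ^ 4) ≤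
      (n : ℝ) ^ (5 * α / 2 - 4) / (δ ^ (3 * α / 2 - 3) * l ^ (3 * α / 2 - 2)) := by
    have e1 : (n : ℝ) ^ 4 ≤ (n : ℝ) ^ (5 * α / 2 - 4) := by
      rw [← Real.rpow_natCast]
      exact Real.rpow_le_rpow_of_exponent_le hn1 (by push_cast; linarith)
    have e2 : δ ^ (3 * α / 2 - 3) ≤ δ ^ 3 := by
      rw [← Real.rpow_natCast]
      exact Real.rpow_le_rpow_of_exponent_ge hδ hδ1.le (by push_cast; linarith)
    have e3 : l ^ (3 * α / 2 - 2) ≤ l ^ 4 := by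
      rw [← Real.rpow_natCast]
      exact Real.rpow_le_rpow_of_exponent_ge hl hl1 (by push_cast; linarith)
    gcongr
  have hK' : (6 * (1 + B ^ 2) * (432 * A) ^ 2 + 12) * ((n : ℝ) ^ 4 / (δ ^ 3 * l ^ 4)) ≤ m :=
    (mul_le_mul_of_nonneg_left hpow (by positivity)).trans hK
  have hm0 : (0 : ℝ) < m := lt_of_lt_of_le (by positivity) hK'
  have hm : 0 < m := Nat.cast_pos.1 hm0
  -- Makes the Markov bound `3 n R / δ` equal to `l/72`, which is the tolerance `c/36` at `c = l/2`.
  set R := l * δ / (216 * n) with hRdef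
  have hR0 : 0 < R := by positivity
  have hmn : 12 * n ^ 2 / (δ * l ^ 2) ≤ m := by
    refine le_trans ?_ hK'
    have e1 : (n : ℝ) ^ 2 ≤ (n : ℝ) ^ 4 := pow_le_pow_right₀ hn1 (by norm_num)
    have e2 : δ ^ 3 ≤ δ := by nlinarith [mul_pos hδ hδ]
    have e3 : l ^ 4 ≤ l ^ 2 := pow_le_pow_of_le_one hl.le hl1 (by norm_num)
    calc 12 * (n : ℝ) ^ 2 / (δ * l ^ 2) ≤ 12 * (n : ℝ) ^ 4 / (δ ^ 3 * l ^ 4) := by gcongr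
      _ = 12 * ((n : ℝ) ^ 4 / (δ ^ 3 * l ^ 4)) := by ring
      _ ≤ _ := by
        gcongr
        nlinarith [mul_nonneg (by positivity : 0 ≤ 6 * (1 + B ^ 2)) (sq_nonneg (432 * A))]
  obtain ⟨G, hG1, hG2, hG3⟩ := exists_good_initialization hn hm hx hy hδ hR0 hl hmn
  refine ⟨G, hG1, hG2, fun W₀ a hz W V hflow t ht => ?_⟩
  obtain ⟨ha, hloss, hgram, hkink⟩ := hG3 W₀ a hz
  refine hflow.loss_le hx ha hα hαγ (by positivity) hR0
    (le_sq_norm_jacobian_adjoint ha hl.le hgram) (hkink.trans_eq ?_) ?_ ht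
  · rw [hRdef]
    field_simp
    norm_num
  · rw [← hA, ← Real.sqrt_mul (by positivity)]
    have h1 : √(n / m * (2 * loss x y W₀ a)) ≤ √(n / m * (2 * (3 * n * (1 + B ^ 2) / δ))) := by
      gcongr
    -- The target is `R (l/2) / A`, so that dividing by `c = l/2` and multiplying by `A` returns
    -- `R`.
    have h2 : √(n / m * (2 * (3 * n * (1 + B ^ 2) / δ))) < l ^ 2 * δ / (432 * A * n) := by
      rw [Real.sqrt_lt' (by positivity)]
      have h3 : 6 * (1 + B ^ 2) * (432 * A) ^ 2 * ((n : ℝ) ^ 4 / (δ ^ 3 * l ^ 4)) < m :=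
        lt_of_lt_of_le (by gcongr; linarith) hK'
      rw [mul_div_assoc', div_lt_iff₀ (by positivity)] at h3
      rw [div_pow, lt_div_iff₀ (by positivity)]
      have e1 : n / m * (2 * (3 * n * (1 + B ^ 2) / δ)) * (432 * A * n) ^ 2 =
          6 * (1 + B ^ 2) * (432 * A) ^ 2 * (n : ℝ) ^ 4 / (m * δ) := by
        field_simp
        ring
      rw [e1, div_lt_iff₀ (by positivity)]
      refine h3.trans_eq ?_
      ring
    calc √(n / m * (2 * loss x y W₀ a)) / (l / 2) * A
        < l ^ 2 * δ / (432 * A * n) / (l / 2) * A := by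
          gcongr
          exact h1.trans_lt h2
      _ = R := by
          rw [hRdef]
          field_simp
          norm_num
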